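/- Let $n\ge 0$, let $\Delta\subset\mathbb R^{n+1}$ be a bounded convex lattice polyhedron (the convex hull of finitely many points of $\mathbb Z^{n+1}$) with non-empty interior, let $v:\Delta\cap\mathbb Z^{n+1}\to\mathbb R$ be any function, and let $a_j\in\mathbb C^*$ for $j\in\Delta\cap\mathbb Z^{n+1}$. For $t>0$ let $$f_t(z)=\sum_{j\in\Delta\cap\mathbb Z^{n+1}}a_j\,t^{-v(j)}z^j,\qquad V^\circ_t=\{z\in(\mathbb C^*)^{n+1} : f_t(z)=0\}.$$ For $t>1$ let $\operatorname{Log}_t(z)=(\log_t|z_1|,\dots,\log_t|z_{n+1}|)$ and let $H_t:(\mathbb C^*)^{n+1}\to(\mathbb C^*)^{n+1}$, $$H_t(z)=\Big(|z_1|^{1/\log t}\frac{z_1}{|z_1|},\dots,|z_{n+1}|^{1/\log t}\frac{z_{n+1}}{|z_{n+1}|}\Big),$$ so that $\operatorname{Log}\circ H_t=\operatorname{Log}_t$, where $\operatorname{Log}(z)=(\log|z_1|,\dots,\log|z_{n+1}|)$. Let $K$ be the field of generalized Puiseux series $b=\sum_{k\in J}b_ks^k$ with $b_k\in\mathbb C^*$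 and $J\subset\mathbb R$ well-ordered. For $b\in K^*$ put $\operatorname{val}(b)=-\min J$, let $u(b)=b_{\min J}/|b_{\min J}|\in S^1$ be the phase of the lowest coefficient, and let $w(b)=e^{\operatorname{val}(b)}u(b)\in\mathbb C^*$. Let $\operatorname{Log}_K:(K^*)^{n+1}\to\mathbb R^{n+1}$ and $W:(K^*)^{n+1}\to(\mathbb C^*)^{n+1}$ be the maps given by $\operatorname{val}$ and by $w$ in each coordinate. Substituting $t=s^{-1}$, view the family $f_t$ as the polynomial $f_K(z)=\sum_{j}a_j\,s^{v(j)}z^j$ over $K$, and let $V^\circ_K=\{z\in(K^*)^{n+1} : f_K(z)=0\}$. Then, as $t\to\infty$, the sets $H_t(V^\circ_t)$ converge to $W(V^\circ_K)$ in the Hausdorff metric, where $(\mathbb C^*)^{n+1}\approx\mathbb R^{n+1}\times(S^1)^{n+1}$ carries the invariant product distance $$d(z,z')=\max\Big\{\|\operatorname{Log}(z)-\operatorname{Log}(z')\|,\ \max_i\Big|\frac{z_i}{|z_i|}-\frac{z'_i}{|z'_i|}\Big|\Big\}.$$ In particular, the amoebas $\operatorname{Log}_t(V^\circ_t)$ converge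 to the non-Archimedean amoeba $\operatorname{Log}_K(V^\circ_K)$ in the Hausdorff metric of the Euclidean space $\mathbb R^{n+1}$. Here the Hausdorff distance of $X$ and $Y$ is $\max\{\sup_{x\in X}d(x,Y),\sup_{y\in Y}d(y,X)\}$, also for sets that are not closed. -/

import Mathlib

open Filter Topology

noncomputable section

namespace Patchworking

/-! ### Lattice polyhedra -/

/-- The inclusion `ℤᵐ ⊆ ℝᵐ`. -/
def toReal {m : ℕ} (j : Fin m → ℤ) : Fin m → ℝ := fun i => (j i : ℝ)

/-- A (bounded) convex lattice polyhedron: the convex hull of finitely many points of `ℤᵐ`. -/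
def IsLatticePolyhedron {m : ℕ} (Δ : Set (Fin m → ℝ)) : Prop :=
  ∃ S : Finset (Fin m → ℤ), Δ = convexHull ℝ (toReal '' (S : Set (Fin m → ℤ)))

/-- The set `Δ ∩ ℤᵐ` of lattice points of `Δ`. -/
def latticePoints {m : ℕ} (Δ : Set (Fin m → ℝ)) : Set (Fin m → ℤ) := {j | toReal j ∈ Δ}

/-- The Laurent monomial `z^j = z₁^{j₁} ⋯ z_m^{j_m}` on the torus `(Fˣ)ᵐ`. -/
def monomial {F : Type*} [Field F] {m : ℕ} (j : Fin m → ℤ) (z : Fin m → Fˣ) : F :=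
  ((∏ i, z i ^ j i : Fˣ) : F)

/-! ### The complex side -/

/-- The patchworking polynomial `f_t(z) = ∑_{j ∈ A} a_j t^{-v(j)} z^j`, for `t > 0`. -/
def patchPoly {m : ℕ} (A : Finset (Fin m → ℤ)) (a : (Fin m → ℤ) → ℂ) (v : (Fin m → ℤ) → ℝ)
    (t : ℝ) (z : Fin m → ℂˣ) : ℂ :=
  ∑ j ∈ A, a j * ((t ^ (-v j) : ℝ) : ℂ) * monomial j z

/-- The hypersurface `V°_t = {f_t = 0}` in `(ℂˣ)ᵐ`. -/
def hypersurface {m : ℕ} (A : Finset (Fin m → ℤ)) (a : (Fin m → ℤ) → ℂ) (v : (Fin m → ℤ) → ℝ)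
    (t : ℝ) : Set (Fin m → ℂˣ) :=
  {z | patchPoly A a v t z = 0}

/-- The phase `c / |c|` of a nonzero complex number. -/
def phase (c : ℂˣ) : Circle :=
  ⟨(c : ℂ) / (‖(c : ℂ)‖ : ℂ), mem_sphere_zero_iff_norm.mpr (by
    rw [norm_div, Complex.norm_real, norm_norm, div_self (norm_ne_zero_iff.mpr c.ne_zero)])⟩

/-- The identification `ℝ × S¹ ≃ ℂˣ`, `(x, θ) ↦ e^x θ`. -/
def ofPolar (x : ℝ) (θ : Circle) : ℂˣ :=
  Units.mk0 ((Real.exp x : ℂ) * (θ : ℂ))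
    (mul_ne_zero (by exact_mod_cast (Real.exp_pos x).ne') θ.coe_ne_zero)

/-- `Log_t(z) = (log_t |z₁|, …, log_t |z_m|)`. -/
def logT {m : ℕ} (t : ℝ) (z : Fin m → ℂˣ) : EuclideanSpace ℝ (Fin m) :=
  WithLp.toLp 2 fun i => Real.logb t ‖(z i : ℂ)‖

/-- `Log(z) = (log |z₁|, …, log |z_m|)`. -/
def log {m : ℕ} (z : Fin m → ℂˣ) : EuclideanSpace ℝ (Fin m) :=
  WithLp.toLp 2 fun i => Real.log ‖(z i : ℂ)‖

/-- The renormalization `H_t` of `(ℂˣ)ᵐ`: phases are kept and `|z_i|` is replaced by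
`|z_i|^{1 / log t} = e^{log_t |z_i|}`, so that `Log ∘ H_t = Log_t`. -/
def renorm {m : ℕ} (t : ℝ) (z : Fin m → ℂˣ) : Fin m → ℂˣ :=
  fun i => ofPolar (Real.logb t ‖(z i : ℂ)‖) (phase (z i))

theorem log_renorm {m : ℕ} (t : ℝ) (z : Fin m → ℂˣ) : log (renorm t z) = logT t z := by
  ext i
  simp [log, renorm, logT, ofPolar, Circle.norm_coe]

/-! ### The non-Archimedean side -/

/-- The field of (generalized) Puiseux series `b = ∑_{k ∈ J} b_k s^k` with complex coefficients,
real exponents and well-ordered `J ⊆ ℝ`. -/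
abbrev Puiseux : Type := HahnSeries ℝ ℂ

/-- `val(b) = - min J`. -/
def val (b : Puiseuxˣ) : ℝ := -(b : Puiseux).order

/-- The coefficient of the lowest power in `b`. -/
def lead (b : Puiseuxˣ) : ℂˣ :=
  Units.mk0 (b : Puiseux).leadingCoeff (HahnSeries.leadingCoeff_ne_zero.mpr b.ne_zero)

/-- The polynomial over `Puiseux` defined by the family `f_t`. The formal variable `s` stands for
`t⁻¹`, which is small as `t → ∞`: the coefficient at `z^j` is `a_j t^{-v(j)} = a_j s^{v(j)}`. -/
def patchPolyK {m : ℕ} (A : Finset (Fin m → ℤ)) (a : (Fin m → ℤ) → ℂ) (v : (Fin m → ℤ) → ℝ)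
    (z : Fin m → Puiseuxˣ) : Puiseux :=
  ∑ j ∈ A, HahnSeries.single (v j) (a j) * monomial j z

/-- The hypersurface `V°_K` in `(Kˣ)ᵐ`. -/
def hypersurfaceK {m : ℕ} (A : Finset (Fin m → ℤ)) (a : (Fin m → ℤ) → ℂ)
    (v : (Fin m → ℤ) → ℝ) : Set (Fin m → Puiseuxˣ) :=
  {z | patchPolyK A a v z = 0}

/-- `Log_K`: the coordinatewise valuation. -/
def logK {m : ℕ} (z : Fin m → Puiseuxˣ) : EuclideanSpace ℝ (Fin m) :=
  WithLp.toLp 2 fun i => val (z i)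

/-- `W : (Kˣ)ᵐ → (ℂˣ)ᵐ`, given in each coordinate by `w = (val, u) : Kˣ → ℝ × S¹ ≃ ℂˣ`, where
`u(b)` is the phase of the coefficient of the lowest power in `b`. -/
def liftW {m : ℕ} (z : Fin m → Puiseuxˣ) : Fin m → ℂˣ :=
  fun i => ofPolar (val (z i)) (phase (lead (z i)))

/-! ### The metric on `(ℂˣ)ᵐ` -/

/-- The identification of `(ℂˣ)ᵐ` with `ℝᵐ × (S¹)ᵐ`. The distance on the target is the maximum of
the Euclidean distance on `ℝᵐ` and of the chordal distances on the circles. -/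
def polar {m : ℕ} (z : Fin m → ℂˣ) : EuclideanSpace ℝ (Fin m) × (Fin m → Circle) :=
  (log z, fun i => phase (z i))

/-- The Hausdorff distance of subsets of `(ℂˣ)ᵐ`, for the invariant metric of `ℝᵐ × (S¹)ᵐ`. -/
def torusHausdorffEDist {m : ℕ} (X Y : Set (Fin m → ℂˣ)) : ENNReal :=
  Metric.hausdorffEDist (polar '' X) (polar '' Y)

end Patchworking

end

/-!
For `x ∈ ℝᵐ` let `A_x ⊆ A` be the set of exponents at which `⟨j, x⟩ - v(j)` is maximal
(`initialSupport`), and let `f_x = ∑_{j ∈ A_x} a_j z^j` be the initial form. Both sides are compared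
with the set of pairs `(x, θ)` such that `f_x` has a zero with phases `θ`.

This set is exactly `W(V°_K)`. The leading coefficients of a point of `V°_K` with valuation `x` are
a zero of `f_x` (`laurentSum_lead_eq_zero`). Conversely a zero `c` of `f_x` lifts (`exists_lift`):
restrict the polynomial over `K` to the line through `c` and a constant point at which `f_x` does
not vanish; this gives a univariate polynomial which is small at `c` and not small at the other
point, and a product over its roots shows that one of them is close to `c`. This uses that the
field `K` of Puiseux series with real exponents is algebraically closed. It is complete for the norm
`e^{val}`, so the norm extends to the algebraic closure; an element outside `K` is normalized to
have trace zero and norm one, and is then congruent to a constant `c`, as are all its conjugates,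
whence `c` is congruent to zero, which is absurd.

All points of `H_t(V°_t)` are close to the limit (`exists_truncation_zero_near`). Along an
ultrafilter of parameters `t → ∞`, the monomials of a zero of `f_t`, divided by the largest one,
have limits `ρ_j ∈ [0, 1]`. On the exponents with `ρ_j ≠ 0` the function `v` and the function
`log ρ` are restrictions of affine functions, because the ranges of linear maps between
finite-dimensional spaces are closed. A correction of size `O(1 / log t)` therefore moves `x` to
a point whose initial support is exactly `{ρ_j ≠ 0}`, and the limit phases are those of a zero of
the initial form there.

All points of the limit are close to `H_t(V°_t)` (`exists_hypersurface_point_near`). Along an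
ultrafilter the initial support `B` is constant, and one fixed zero of the initial form serves for
all phases near their limit. A translation of `x` by a fixed small difference `η (x_p - x_q)` makes
the terms outside `B` smaller by a factor `t^{-d}` with fixed `d > 0`, and the lemma on zeros on
a line (`exists_zero_on_line`), now over `ℂ`, turns the zero of the initial form into a zero
of `f_t`.

The statement on amoebas follows, since the projection of the torus to `ℝᵐ` is `1`-Lipschitz.
-/

noncomputable section

namespace Patchworking

/-! ### The valuation norm on the field of generalized Puiseux series -/

open Classical in
/-- The absolute value `‖b‖ = e^{val b}` on the field of Puiseux series. -/
def puiseuxAbs : AbsoluteValue Puiseux ℝ where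
  toFun b := if b = 0 then 0 else Real.exp (-b.order)
  map_mul' x y := by
    by_cases hx : x = 0
    · simp [hx]
    by_cases hy : y = 0
    · simp [hy]
    simp only [hx, hy, mul_eq_zero, or_self, if_false]
    rw [HahnSeries.order_mul hx hy, neg_add, Real.exp_add]
  nonneg' x := by split_ifs <;> positivity
  eq_zero' x := by simp [Real.exp_ne_zero]
  add_le' x y := by
    by_cases hx : x = 0
    · simp [hx]
    by_cases hy : y = 0
    · simp [hy]
    by_cases hxy : x + y = 0
    · simp only [hxy, if_true]
      positivity
    simp only [hx, hy, hxy, if_false]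
    rcases min_le_iff.mp (HahnSeries.min_order_le_order_add (x := x) (y := y) hxy) with h | h
    · have := Real.exp_le_exp.mpr (neg_le_neg h)
      linarith [Real.exp_pos (-y.order)]
    · have := Real.exp_le_exp.mpr (neg_le_neg h)
      linarith [Real.exp_pos (-x.order)]

/-- The field of Puiseux series with the norm `‖b‖ = e^{val b}`. -/
instance : NormedField Puiseux := puiseuxAbs.toNormedField

theorem norm_puiseux {b : Puiseux} (hb : b ≠ 0) : ‖b‖ = Real.exp (-b.order) := by
  exact if_neg hb

theorem norm_puiseux_le_iff {b : Puiseux} {g : ℝ} :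
    ‖b‖ ≤ Real.exp (-g) ↔ ∀ h < g, b.coeff h = 0 := by
  by_cases hb : b = 0
  · simp [hb, Real.exp_nonneg]
  rw [norm_puiseux hb, Real.exp_le_exp, neg_le_neg_iff, HahnSeries.le_order_iff_forall hb]

theorem norm_puiseux_lt_iff {b : Puiseux} {g : ℝ} :
    ‖b‖ < Real.exp (-g) ↔ ∀ h ≤ g, b.coeff h = 0 := by
  by_cases hb : b = 0
  · simp [hb, Real.exp_pos]
  rw [norm_puiseux hb, Real.exp_lt_exp, neg_lt_neg_iff]
  constructor
  · intro h k hk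
    exact HahnSeries.coeff_eq_zero_of_lt_order (hk.trans_lt h)
  · intro h
    by_contra hc
    exact hb (HahnSeries.coeff_order_eq_zero.mp (h _ (not_lt.mp hc)))

theorem norm_puiseux_lt_one_iff {b : Puiseux} : ‖b‖ < 1 ↔ ∀ h ≤ 0, b.coeff h = 0 := by
  simpa using norm_puiseux_lt_iff (b := b) (g := 0)

theorem norm_puiseux_le_one_iff {b : Puiseux} : ‖b‖ ≤ 1 ↔ ∀ h < 0, b.coeff h = 0 := by
  simpa using norm_puiseux_le_iff (b := b) (g := 0)

theorem norm_single {g : ℝ} {c : ℂ} (hc : c ≠ 0) :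
    ‖(HahnSeries.single g c : Puiseux)‖ = Real.exp (-g) := by
  rw [norm_puiseux (HahnSeries.single_ne_zero hc), HahnSeries.order_single hc]

theorem norm_C {c : ℂ} (hc : c ≠ 0) : ‖(HahnSeries.C c : Puiseux)‖ = 1 := by
  rw [HahnSeries.C_apply, norm_single hc, neg_zero, Real.exp_zero]

theorem norm_C_le (c : ℂ) : ‖(HahnSeries.C c : Puiseux)‖ ≤ 1 := by
  by_cases hc : c = 0
  · simp [hc]
  · exact (norm_C hc).le

/-- The residue of a Puiseux series of norm at most one is its constant coefficient. -/
theorem norm_sub_C_lt_one {b : Puiseux} (hb : ‖b‖ ≤ 1) :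
    ‖b - HahnSeries.C (b.coeff 0)‖ < 1 := by
  rw [norm_puiseux_lt_one_iff]
  intro h hh
  rcases hh.lt_or_eq with hh | rfl
  · simp [norm_puiseux_le_one_iff.mp hb h hh, HahnSeries.C_apply,
      HahnSeries.coeff_single_of_ne hh.ne]
  · simp [HahnSeries.C_apply]

instance : IsUltrametricDist Puiseux :=
  IsUltrametricDist.isUltrametricDist_of_forall_norm_add_le_max_norm fun x y => by
    by_cases hx : x = 0
    · simp [hx]
    by_cases hy : y = 0
    · simp [hy]
    by_cases hxy : x + y = 0
    · simp [hxy]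
    rw [norm_puiseux hx, norm_puiseux hy, norm_puiseux hxy, le_max_iff, Real.exp_le_exp,
      Real.exp_le_exp, neg_le_neg_iff, neg_le_neg_iff]
    exact min_le_iff.mp (HahnSeries.min_order_le_order_add hxy)

instance : NontriviallyNormedField Puiseux where
  non_trivial := ⟨HahnSeries.single (-1 : ℝ) (1 : ℂ), by
    rw [norm_single one_ne_zero, neg_neg]
    exact Real.one_lt_exp_iff.mpr one_pos⟩

/-- Coefficients of a Cauchy sequence are eventually constant, uniformly on half-lines
`(-∞, g]`; so the limit series has well-ordered support. -/
instance : CompleteSpace Puiseux := by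
  refine Metric.complete_of_cauchySeq_tendsto fun u hu => ?_
  have key : ∀ g : ℝ, ∃ N, ∀ n ≥ N, ∀ h ≤ g, (u n).coeff h = (u N).coeff h := by
    intro g
    obtain ⟨N, hN⟩ := Metric.cauchySeq_iff'.mp hu (Real.exp (-g)) (Real.exp_pos _)
    refine ⟨N, fun n hn h hh => ?_⟩
    have := hN n hn
    rw [dist_eq_norm, norm_puiseux_lt_iff] at this
    simpa [sub_eq_zero] using this h hh
  choose N hN using key
  have agree : ∀ g h, h ≤ g → (u (N h)).coeff h = (u (N g)).coeff h := by
    intro g h hh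
    rw [← hN h (max (N h) (N g)) (le_max_left _ _) h le_rfl,
      hN g (max (N h) (N g)) (le_max_right _ _) h hh]
  let b : Puiseux :=
    { coeff := fun g => (u (N g)).coeff g
      isPWO_support' := by
        intro f
        by_cases h0 : ∃ n, 0 < n ∧ (f 0 : ℝ) ≤ f n
        · obtain ⟨n, hn, hf⟩ := h0
          exact ⟨0, n, hn, hf⟩
        push Not at h0
        -- Otherwise the sequence stays below `f 0`, where the limit agrees with one term of `u`.
        have hle : ∀ n, (f n : ℝ) ≤ f 0 := fun n => by
          rcases Nat.eq_zero_or_pos n with rfl | hn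
          · exact le_rfl
          · exact (h0 n hn).le
        have hs : ∀ n, (f n : ℝ) ∈ Function.support (u (N (f 0))).coeff := fun n => by
          have := (f n).2
          rw [Function.mem_support] at this ⊢
          rwa [← agree _ _ (hle n)]
        exact (u (N (f 0))).isPWO_support' fun n => ⟨f n, hs n⟩ }
  refine ⟨b, Metric.tendsto_atTop.mpr fun ε hε => ?_⟩
  refine ⟨N (-Real.log ε), fun n hn => ?_⟩
  have : ε = Real.exp (-(-Real.log ε)) := by rw [neg_neg, Real.exp_log hε]
  rw [this, dist_eq_norm, norm_puiseux_lt_iff]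
  intro h hh
  rw [HahnSeries.coeff_sub, hN _ n hn h hh, sub_eq_zero]
  exact (agree _ _ hh).symm

section

/-! ### The field of generalized Puiseux series is algebraically closed -/

open Polynomial

theorem norm_sub_le_max {F : Type*} [NormedField F] [IsUltrametricDist F] (x y : F) :
    ‖x - y‖ ≤ max ‖x‖ ‖y‖ := by
  rw [sub_eq_add_neg, ← norm_neg y]
  exact IsUltrametricDist.norm_add_le_max _ _

theorem norm_sum_lt_one {ι F : Type*} [NormedField F] [IsUltrametricDist F] (s : Finset ι)
    (f : ι → F) (h : ∀ i ∈ s, ‖f i‖ < 1) : ‖∑ i ∈ s, f i‖ < 1 := by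
  classical
  induction s using Finset.induction_on with
  | empty => simp
  | insert i s hi ih =>
    rw [Finset.sum_insert hi]
    refine (IsUltrametricDist.norm_add_le_max _ _).trans_lt (max_lt (h i (by simp)) (ih ?_))
    exact fun k hk => h k (by simp [hk])

/-- An integral monic polynomial over the Puiseux series takes a value in the maximal ideal at
some constant, namely at a root of its reduction. -/
theorem exists_C_norm_eval_lt_one {Q : Puiseux[X]} (hQ : Q.Monic) (hdeg : 0 < Q.natDegree)
    (hint : ∀ n, ‖Q.coeff n‖ ≤ 1) : ∃ c : ℂ, ‖Q.eval (HahnSeries.C c)‖ < 1 := by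
  let q : ℂ[X] := ∑ n ∈ Finset.range (Q.natDegree + 1), Polynomial.monomial n ((Q.coeff n).coeff 0)
  have hcoeff : ∀ n, q.coeff n = (Q.coeff n).coeff 0 := by
    intro n
    simp only [q, finsetSum_coeff, coeff_monomial, Finset.sum_ite_eq', Finset.mem_range]
    split_ifs with h
    · rfl
    · rw [coeff_eq_zero_of_natDegree_lt (by omega)]
      rfl
  have hq : q.degree ≠ 0 := by
    have h1 : q.coeff Q.natDegree ≠ 0 := by
      rw [hcoeff, hQ.coeff_natDegree]
      simp
    have := le_natDegree_of_ne_zero h1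
    intro h0
    have := natDegree_eq_zero_iff_degree_le_zero.mpr h0.le
    omega
  obtain ⟨c, hc⟩ := IsAlgClosed.exists_root q hq
  refine ⟨c, ?_⟩
  have h0 : ∑ n ∈ Finset.range (Q.natDegree + 1), (Q.coeff n).coeff 0 * c ^ n = 0 := by
    have := hc.eq_zero
    simpa [q, eval_finsetSum, eval_monomial] using this
  have h1 : Q.eval (HahnSeries.C c) = ∑ n ∈ Finset.range (Q.natDegree + 1),
      (Q.coeff n - HahnSeries.C ((Q.coeff n).coeff 0)) * (HahnSeries.C c) ^ n := by
    have h2 := congrArg (HahnSeries.C (Γ := ℝ)) h0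
    rw [map_sum, map_zero] at h2
    simp only [map_mul, map_pow] at h2
    simp only [sub_mul, Finset.sum_sub_distrib]
    rw [h2, sub_zero, eval_eq_sum_range]
  rw [h1]
  refine norm_sum_lt_one _ _ fun n _ => ?_
  rw [norm_mul, norm_pow]
  refine (mul_le_of_le_one_right (norm_nonneg _)
    (pow_le_one₀ (norm_nonneg _) (norm_C_le c))).trans_lt (norm_sub_C_lt_one (hint n))

/-- The residue field of the algebraic closure is still `ℂ`. -/
theorem exists_spectralNorm_sub_lt_one {L : Type*} [Field L] [Algebra Puiseux L]
    [Algebra.IsAlgebraic Puiseux L] {γ : L} (hγ : spectralNorm Puiseux L γ ≤ 1) :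
    ∃ c : ℂ, spectralNorm Puiseux L (γ - algebraMap Puiseux L (HahnSeries.C c)) < 1 := by
  have hi : IsIntegral Puiseux γ := Algebra.IsIntegral.isIntegral γ
  obtain ⟨c, hc⟩ := exists_C_norm_eval_lt_one (minpoly.monic hi) (minpoly.natDegree_pos hi)
    ((spectralValue_le_one_iff (minpoly.monic hi)).mp hγ)
  refine ⟨c, ?_⟩
  rw [spectralNorm.spectralNorm_eq_norm_coeff_zero_rpow, minpoly.sub_algebraMap,
    coeff_zero_eq_eval_zero, eval_comp]
  simp only [eval_add, eval_X, eval_C, zero_add]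
  refine Real.rpow_lt_one (norm_nonneg _) hc ?_
  rw [natDegree_comp, natDegree_X_add_C, mul_one]
  have := minpoly.natDegree_pos hi
  positivity

/-- The proof is the Tschirnhaus argument: an element outside the base field may be normalized to
have trace zero and norm one. It is then congruent to a constant `c`, and so are all its conjugates,
so `c` is congruent to `0`, which contradicts that the norm is one. -/
instance : IsAlgClosed Puiseux := by
  refine IsAlgClosed.of_exists_root _ fun p hp hirr => ?_
  let L := AlgebraicClosure Puiseux
  obtain ⟨α, hα⟩ := IsAlgClosed.exists_aeval_eq_zero L p hirr.degree_pos.ne'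
  suffices h : ∃ τ : Puiseux, algebraMap Puiseux L τ = α by
    obtain ⟨τ, rfl⟩ := h
    refine ⟨τ, ?_⟩
    rw [aeval_algebraMap_apply] at hα
    exact (map_eq_zero _).mp hα
  have hi : IsIntegral Puiseux α := Algebra.IsIntegral.isIntegral α
  set P := minpoly Puiseux α with hP
  have hPm : P.Monic := minpoly.monic hi
  have hd : 0 < P.natDegree := minpoly.natDegree_pos hi
  set R := (P.map (algebraMap Puiseux L)).roots with hR
  have hsplit : (P.map (algebraMap Puiseux L)).Splits := IsAlgClosed.splits _
  have hcard : (R.card : Puiseux) ≠ 0 := by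
    rw [hR, splits_iff_card_roots.mp hsplit, natDegree_map]
    have : CharZero Puiseux :=
      charZero_of_injective_ringHom (HahnSeries.C_injective (Γ := ℝ) (R := ℂ))
    exact_mod_cast hd.ne'
  set τ : Puiseux := -P.nextCoeff / R.card with hτ
  have hsum : R.sum = R.card • algebraMap Puiseux L τ := by
    have h1 := hsplit.nextCoeff_eq_neg_sum_roots_of_monic (hPm.map _)
    rw [nextCoeff_map (algebraMap Puiseux L).injective] at h1
    rw [nsmul_eq_mul, ← map_natCast (algebraMap Puiseux L), ← map_mul, hτ, mul_div_cancel₀ _ hcard,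
      map_neg, h1, neg_neg]
  refine ⟨τ, ?_⟩
  by_contra hne
  let N := spectralMulAlgNorm Puiseux L
  have hN : ∀ x, N x = spectralNorm Puiseux L x := fun x => rfl
  have hNK : ∀ x : Puiseux, N (algebraMap Puiseux L x) = ‖x‖ := fun x => spectralNorm_extends x
  have hβ : α - algebraMap Puiseux L τ ≠ 0 := fun h => hne (sub_eq_zero.mp h).symm
  have hβN : 0 < N (α - algebraMap Puiseux L τ) := by
    rw [hN]
    exact spectralNorm_zero_lt hβ (Algebra.IsAlgebraic.isAlgebraic _)
  -- The value group is `ℝ`, so some monomial `s^g` has the norm of `α - τ`.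
  set s : Puiseux := HahnSeries.single (-Real.log (N (α - algebraMap Puiseux L τ))) (1 : ℂ) with hs
  have hsN : ‖s‖ = N (α - algebraMap Puiseux L τ) := by
    rw [hs, norm_single one_ne_zero, neg_neg, Real.exp_log hβN]
  have hs0 : algebraMap Puiseux L s ≠ 0 := by
    rw [Ne, map_eq_zero, ← norm_eq_zero, hsN]
    exact hβN.ne'
  set γ := (α - algebraMap Puiseux L τ) / algebraMap Puiseux L s with hγ
  have hγN : N γ = 1 := by
    have h1 : N (γ * algebraMap Puiseux L s) = N (α - algebraMap Puiseux L τ) := by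
      rw [hγ, div_mul_cancel₀ _ hs0]
    rw [map_mul, hNK, hsN] at h1
    exact (mul_eq_right₀ hβN.ne').mp h1
  obtain ⟨c, hc⟩ := exists_spectralNorm_sub_lt_one (γ := γ) hγN.le
  have hconj : ∀ x ∈ R, N ((x - algebraMap Puiseux L τ) / algebraMap Puiseux L s
      - algebraMap Puiseux L (HahnSeries.C c)) < 1 := by
    intro x hx
    have hx0 : IsConjRoot Puiseux x α := by
      rw [hR, mem_roots (hPm.map _).ne_zero, IsRoot.def, eval_map_algebraMap] at hx
      exact ((isConjRoot_iff_aeval_eq_zero hi).mpr hx).symm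
    obtain ⟨σ, hσ⟩ := isConjRoot_iff_exists_algEquiv.mp hx0
    have : (x - algebraMap Puiseux L τ) / algebraMap Puiseux L s
      - algebraMap Puiseux L (HahnSeries.C c) = σ (γ - algebraMap Puiseux L (HahnSeries.C c)) := by
      simp [hγ, hσ]
    rw [this, hN, ← spectralNorm_eq_of_equiv σ]
    exact hc
  have hultra : ∀ S : Multiset L, (∀ x ∈ S, N x < 1) → N S.sum < 1 := by
    intro S
    induction S using Multiset.induction_on with
    | empty => simp
    | cons a S ih =>
      intro h
      rw [Multiset.sum_cons]
      refine (isNonarchimedean_spectralNorm (K := Puiseux) (L := L) a S.sum).trans_lt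
        (max_lt (h a (by simp)) (ih fun x hx => h x (by simp [hx])))
  have htot := hultra (R.map fun x => (x - algebraMap Puiseux L τ) / algebraMap Puiseux L s
      - algebraMap Puiseux L (HahnSeries.C c)) (by
    intro y hy
    obtain ⟨x, hx, rfl⟩ := Multiset.mem_map.mp hy
    exact hconj x hx)
  have hzero : (R.map fun x => (x - algebraMap Puiseux L τ) / algebraMap Puiseux L s
      - algebraMap Puiseux L (HahnSeries.C c)).sum =
      algebraMap Puiseux L (HahnSeries.C (-(R.card * c))) := by
    rw [Multiset.sum_map_sub, Multiset.sum_map_div, Multiset.sum_map_sub, Multiset.map_id', hsum]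
    simp only [Multiset.map_const', Multiset.sum_replicate, map_neg, map_mul, map_natCast,
      nsmul_eq_mul, sub_self, zero_div, zero_sub]
  rw [hzero, hNK] at htot
  have hc0 : c = 0 := by
    by_contra hc0
    rw [norm_C] at htot
    · exact lt_irrefl _ htot
    · refine neg_ne_zero.mpr (mul_ne_zero ?_ hc0)
      intro h
      apply hcard
      have : R.card = 0 := by exact_mod_cast h
      rw [this, Nat.cast_zero]
  rw [hc0, map_zero, map_zero, sub_zero, ← hN, hγN] at hc
  exact lt_irrefl _ hc

end

/-! ### Laurent polynomials on the torus -/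

/-- The Laurent polynomial `∑_{j ∈ A} b_j z^j`, evaluated at a point of the torus. -/
def laurentSum {F : Type*} [Field F] {m : ℕ} (A : Finset (Fin m → ℤ)) (b : (Fin m → ℤ) → F)
    (z : Fin m → Fˣ) : F :=
  ∑ j ∈ A, b j * monomial j z

theorem monomial_mul {F : Type*} [Field F] {m : ℕ} (j : Fin m → ℤ) (y z : Fin m → Fˣ) :
    monomial j (fun i => y i * z i) = monomial j y * monomial j z := by
  simp [monomial, mul_zpow, Finset.prod_mul_distrib]

theorem monomial_map {F G : Type*} [Field F] [Field G] {m : ℕ} (φ : F →+* G) (j : Fin m → ℤ)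
    (z : Fin m → Fˣ) :
    monomial j (fun i => Units.map (φ : F →* G) (z i)) = φ (monomial j z) := by
  change _ = ((Units.map (φ : F →* G) (∏ i, z i ^ j i) : Gˣ) : G)
  rw [map_prod]
  simp only [map_zpow, monomial]

/-- A nonzero Laurent polynomial does not vanish identically on the torus: the monomials are
pairwise distinct characters. -/
theorem exists_laurentSum_ne_zero {m : ℕ} {B : Finset (Fin m → ℤ)} {a : (Fin m → ℤ) → ℂ}
    (hB : B.Nonempty) (ha : ∀ j ∈ B, a j ≠ 0) : ∃ y : Fin m → ℂˣ, laurentSum B a y ≠ 0 := by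
  let χ : (Fin m → ℤ) → ((Fin m → ℂˣ) →* ℂ) := fun j =>
    { toFun := monomial j
      map_one' := by simp [monomial]
      map_mul' := monomial_mul j }
  have hχ : Function.Injective χ := by
    intro j k hjk
    ext i
    have h2 : (2 : ℂ) ≠ 0 := two_ne_zero
    have h := DFunLike.congr_fun hjk (Pi.mulSingle i (Units.mk0 2 h2))
    change monomial j _ = monomial k _ at h
    have hm : ∀ l : Fin m → ℤ, monomial l (Pi.mulSingle i (Units.mk0 (2 : ℂ) h2)) = 2 ^ l i := by
      intro l
      rw [monomial, Finset.prod_eq_single i]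
      · simp
      · intro k _ hk
        rw [Pi.mulSingle_eq_of_ne hk, one_zpow]
      · simp
    rw [hm, hm] at h
    have h' : (2 : ℝ) ^ j i = (2 : ℝ) ^ k i := by
      simpa [norm_zpow] using congrArg norm h
    exact zpow_right_injective₀ (by norm_num) (by norm_num) h'
  have hli := (linearIndependent_monoidHom (Fin m → ℂˣ) ℂ).comp χ hχ
  by_contra! h
  obtain ⟨j, hj⟩ := hB
  refine ha j hj (linearIndependent_iff'.mp hli B a ?_ j hj)
  ext y
  simpa [laurentSum, χ] using h y

section

/-! ### Zeros of polynomials near an approximate zero -/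

open Polynomial

/-- If all roots of `P` were at distance at least `ρ` from `0`, then `P(1) / P(0)` would be a
product of at most `deg P` factors of norm at most `C`. -/
theorem exists_root_norm_lt {F : Type*} [NormedField F] [IsAlgClosed F] {P : F[X]} {C ρ : ℝ}
    {D : ℕ} (hC1 : 1 ≤ C) (hC : ∀ α : F, ρ ≤ ‖α‖ → ‖1 - α‖ ≤ C * ‖α‖) (hD : P.natDegree ≤ D)
    (h : C ^ D * ‖P.eval 0‖ < ‖P.eval 1‖) : ∃ ζ, P.eval ζ = 0 ∧ ‖ζ‖ < ρ := by
  by_contra! hno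
  have hP : P ≠ 0 := by
    rintro rfl
    simp at h
  have hs : P.Splits := IsAlgClosed.splits P
  have hroots : ∀ α ∈ P.roots, ‖1 - α‖ ≤ C * ‖0 - α‖ := fun α hα => by
    rw [zero_sub, norm_neg]
    exact hC α (hno α ((mem_roots hP).mp hα).eq_zero)
  have hprod : ∀ S : Multiset F, (∀ α ∈ S, ‖1 - α‖ ≤ C * ‖0 - α‖) →
      ‖(S.map (1 - ·)).prod‖ ≤ C ^ S.card * ‖(S.map (0 - ·)).prod‖ := by
    intro S
    induction S using Multiset.induction_on with
    | empty => simp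
    | cons α S ih =>
      intro hS
      rw [Multiset.map_cons, Multiset.map_cons, Multiset.prod_cons, Multiset.prod_cons, norm_mul,
        norm_mul, Multiset.card_cons]
      calc ‖1 - α‖ * ‖(S.map (1 - ·)).prod‖
          ≤ (C * ‖0 - α‖) * (C ^ S.card * ‖(S.map (0 - ·)).prod‖) :=
            mul_le_mul (hS α (by simp)) (ih fun β hβ => hS β (by simp [hβ])) (norm_nonneg _)
              (by positivity)
        _ = _ := by ring
  have h1 := hprod _ hroots
  rw [hs.eval_eq_prod_roots, hs.eval_eq_prod_roots, norm_mul, norm_mul] at h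
  have h2 : C ^ P.roots.card ≤ C ^ D := pow_le_pow_right₀ hC1 ((card_roots' P).trans hD)
  have h3 : ‖(P.roots.map (1 - ·)).prod‖ ≤ C ^ D * ‖(P.roots.map (0 - ·)).prod‖ :=
    h1.trans (mul_le_mul_of_nonneg_right h2 (norm_nonneg _))
  have h4 := mul_le_mul_of_nonneg_left h3 (norm_nonneg P.leadingCoeff)
  linarith

/-- An exponent `N` such that `(z₁ ⋯ z_m)^N` clears the denominators of all `z^j`, `j ∈ A`. -/
def clearingExponent {m : ℕ} (A : Finset (Fin m → ℤ)) : ℕ :=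
  ∑ j ∈ A, ∑ i, (j i).natAbs

/-- A bound, in terms of `A` only, for the degree of a Laurent polynomial with
support `A` on a line, after clearing denominators. -/
def lineDegree {m : ℕ} (A : Finset (Fin m → ℤ)) : ℕ :=
  ∑ j ∈ A, ∑ i, (j i + clearingExponent A).toNat

theorem clearingExponent_spec {m : ℕ} {A : Finset (Fin m → ℤ)} {j : Fin m → ℤ} (hj : j ∈ A)
    (i : Fin m) : 0 ≤ j i + clearingExponent A := by
  have h1 : (j i).natAbs ≤ ∑ i, (j i).natAbs :=
    Finset.single_le_sum (f := fun i => (j i).natAbs) (fun _ _ => Nat.zero_le _)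
      (Finset.mem_univ i)
  have h2 : ∑ i, (j i).natAbs ≤ clearingExponent A :=
    Finset.single_le_sum (f := fun j : Fin m → ℤ => ∑ i, (j i).natAbs) (fun _ _ => Nat.zero_le _) hj
  omega

/-- The restriction of a Laurent polynomial to the line through `y₀` and `y₁`, after clearing
denominators. -/
def linePoly {F : Type*} [Field F] {m : ℕ} (A : Finset (Fin m → ℤ)) (b : (Fin m → ℤ) → F)
    (y₀ y₁ : Fin m → Fˣ) : F[X] :=
  ∑ j ∈ A, C (b j) *
    ∏ i, (C (y₀ i : F) + X * C ((y₁ i : F) - y₀ i)) ^ (j i + clearingExponent A).toNat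

theorem natDegree_linePoly_le {F : Type*} [Field F] {m : ℕ} (A : Finset (Fin m → ℤ))
    (b : (Fin m → ℤ) → F) (y₀ y₁ : Fin m → Fˣ) :
    (linePoly A b y₀ y₁).natDegree ≤ lineDegree A := by
  refine natDegree_sum_le_of_forall_le _ _ fun j hj => ?_
  refine (natDegree_C_mul_le _ _).trans ((natDegree_prod_le _ _).trans ?_)
  refine le_trans (Finset.sum_le_sum fun i _ => ?_)
    (Finset.single_le_sum (f := fun j : Fin m → ℤ => ∑ i, (j i + clearingExponent A).toNat)
      (fun _ _ => Nat.zero_le _) hj)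
  refine natDegree_pow_le.trans (mul_le_of_le_one_right (Nat.zero_le _) ?_)
  rw [add_comm, mul_comm]
  exact natDegree_linear_le

theorem eval_linePoly {F : Type*} [Field F] {m : ℕ} (A : Finset (Fin m → ℤ))
    (b : (Fin m → ℤ) → F) {y₀ y₁ u : Fin m → Fˣ} {ζ : F}
    (hu : ∀ i, (u i : F) = y₀ i + ζ * (y₁ i - y₀ i)) :
    (linePoly A b y₀ y₁).eval ζ = (∏ i, (u i : F)) ^ clearingExponent A * laurentSum A b u := by
  simp only [linePoly, laurentSum, eval_finsetSum, Finset.mul_sum]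
  refine Finset.sum_congr rfl fun j hj => ?_
  rw [eval_mul, eval_C, eval_prod, mul_left_comm]
  congr 1
  simp only [monomial, Units.coe_prod]
  rw [← Finset.prod_pow, ← Finset.prod_mul_distrib]
  refine Finset.prod_congr rfl fun i _ => ?_
  rw [eval_pow, eval_add, eval_mul, eval_C, eval_C, eval_X, ← hu, ← zpow_natCast,
    Int.toNat_of_nonneg (clearingExponent_spec hj i), zpow_add₀ (u i).ne_zero,
    Units.val_zpow_eq_zpow_val, zpow_natCast, mul_comm]

/-- A Laurent polynomial which is small at `y₀` and not so small at `y₁` has a zero on the line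
through `y₀` and `y₁`, close to `y₀`. -/
theorem exists_zero_on_line {F : Type*} [NormedField F] [IsAlgClosed F] {m : ℕ}
    (A : Finset (Fin m → ℤ)) (b : (Fin m → ℤ) → F) (y₀ y₁ : Fin m → Fˣ) {K ρ : ℝ}
    (hK1 : 1 ≤ K) (hK : ∀ α : F, ρ ≤ ‖α‖ → ‖1 - α‖ ≤ K * ‖α‖)
    (hline : ∀ ζ : F, ‖ζ‖ < ρ → ∀ i, (y₀ i : F) + ζ * (y₁ i - y₀ i) ≠ 0)
    (h : K ^ lineDegree A * ‖(∏ i, (y₀ i : F)) ^ clearingExponent A * laurentSum A b y₀‖ <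
      ‖(∏ i, (y₁ i : F)) ^ clearingExponent A * laurentSum A b y₁‖) :
    ∃ ζ : F, ‖ζ‖ < ρ ∧ ∃ u : Fin m → Fˣ, (∀ i, (u i : F) = y₀ i + ζ * (y₁ i - y₀ i)) ∧
      laurentSum A b u = 0 := by
  rw [← eval_linePoly A b (y₀ := y₀) (y₁ := y₁) (ζ := 0) (by simp),
    ← eval_linePoly A b (y₀ := y₀) (y₁ := y₁) (ζ := 1) (by simp)] at h
  obtain ⟨ζ, hζ, hζρ⟩ := exists_root_norm_lt hK1 hK (natDegree_linePoly_le A b y₀ y₁) h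
  let u : Fin m → Fˣ := fun i => Units.mk0 _ (hline ζ hζρ i)
  refine ⟨ζ, hζρ, u, fun i => rfl, ?_⟩
  rw [eval_linePoly A b (u := u) fun i => rfl] at hζ
  exact (mul_eq_zero.mp hζ).resolve_left
    (pow_ne_zero _ (Finset.prod_ne_zero_iff.mpr fun i _ => (u i).ne_zero))

end

/-! ### Initial forms and the non-Archimedean hypersurface -/

/-- The affine function `⟨j, x⟩ - v(j)`: the exponent of `t` in `a_j t^{-v(j)} z^j` when
`Log_t(z) = x`. -/
def height {m : ℕ} (v : (Fin m → ℤ) → ℝ) (j : Fin m → ℤ) (x : Fin m → ℝ) : ℝ :=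
  toReal j ⬝ᵥ x - v j

/-- The set of exponents `j ∈ A` at which `⟨j, x⟩ - v(j)` is maximal. -/
def initialSupport {m : ℕ} (A : Finset (Fin m → ℤ)) (v : (Fin m → ℤ) → ℝ) (x : Fin m → ℝ) :
    Finset (Fin m → ℤ) :=
  {j ∈ A | ∀ k ∈ A, height v k x ≤ height v j x}

section

variable {m : ℕ} {A : Finset (Fin m → ℤ)} {a : (Fin m → ℤ) → ℂ} {v : (Fin m → ℤ) → ℝ}

theorem mem_initialSupport {x : Fin m → ℝ} {j : Fin m → ℤ} :
    j ∈ initialSupport A v x ↔ j ∈ A ∧ ∀ k ∈ A, height v k x ≤ height v j x :=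
  Finset.mem_filter

theorem initialSupport_subset (x : Fin m → ℝ) : initialSupport A v x ⊆ A :=
  Finset.filter_subset _ _

theorem initialSupport_nonempty (hA : A.Nonempty) (x : Fin m → ℝ) :
    (initialSupport A v x).Nonempty := by
  obtain ⟨j, hj, hmax⟩ := A.exists_max_image (fun j => height v j x) hA
  exact ⟨j, mem_initialSupport.mpr ⟨hj, hmax⟩⟩

theorem height_eq_of_mem {x : Fin m → ℝ} {j k : Fin m → ℤ} (hj : j ∈ initialSupport A v x)
    (hk : k ∈ initialSupport A v x) : height v j x = height v k x :=
  le_antisymm ((mem_initialSupport.mp hk).2 j (mem_initialSupport.mp hj).1)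
    ((mem_initialSupport.mp hj).2 k (mem_initialSupport.mp hk).1)

theorem height_lt_of_notMem {x : Fin m → ℝ} {j k : Fin m → ℤ} (hj : j ∈ initialSupport A v x)
    (hk : k ∈ A) (hkn : k ∉ initialSupport A v x) : height v k x < height v j x := by
  have hj' := mem_initialSupport.mp hj
  refine lt_of_le_of_ne (hj'.2 k hk) fun h => hkn (mem_initialSupport.mpr ⟨hk, fun l hl => ?_⟩)
  rw [h]
  exact hj'.2 l hl

/-- `val` as a homomorphism. -/
def valHom : Puiseuxˣ →* Multiplicative ℝ where
  toFun b := Multiplicative.ofAdd (val b)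
  map_one' := by simp [val]
  map_mul' b c := by
    rw [← ofAdd_add, val, val, val, Units.val_mul, HahnSeries.order_mul b.ne_zero c.ne_zero,
      neg_add]

/-- `lead` as a homomorphism. -/
def leadHom : Puiseuxˣ →* ℂˣ where
  toFun := lead
  map_one' := by ext; simp [lead]
  map_mul' b c := by ext; simp [lead, HahnSeries.leadingCoeff_mul]

theorem val_monomial (j : Fin m → ℤ) (z : Fin m → Puiseuxˣ) :
    val (∏ i, z i ^ j i) = toReal j ⬝ᵥ fun i => val (z i) := by
  have h : valHom (∏ i, z i ^ j i) = ∏ i, valHom (z i) ^ j i := by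
    simp only [map_prod, map_zpow]
  have h' := congrArg Multiplicative.toAdd h
  simp only [toAdd_prod, toAdd_zpow, zsmul_eq_mul] at h'
  exact h'

theorem lead_monomial (j : Fin m → ℤ) (z : Fin m → Puiseuxˣ) :
    lead (∏ i, z i ^ j i) = ∏ i, lead (z i) ^ j i := by
  change leadHom _ = ∏ i, leadHom (z i) ^ j i
  simp

/-- The leading coefficients of a point of the hypersurface over the Puiseux series are a zero of
the initial form at its valuation. -/
theorem laurentSum_lead_eq_zero (hA : A.Nonempty) {z : Fin m → Puiseuxˣ}
    (hz : z ∈ hypersurfaceK A a v) :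
    laurentSum (initialSupport A v fun i => val (z i)) a (fun i => lead (z i)) = 0 := by
  set x : Fin m → ℝ := fun i => val (z i) with hx
  obtain ⟨j₀, hj₀⟩ := initialSupport_nonempty (v := v) hA x
  have h0 : (patchPolyK A a v z).coeff (-height v j₀ x) = 0 := by
    rw [show patchPolyK A a v z = 0 from hz, HahnSeries.coeff_zero]
  rw [patchPolyK, HahnSeries.coeff_sum] at h0
  rw [← h0, laurentSum]
  refine Finset.sum_subset_zero_on_sdiff (initialSupport_subset x) (fun j hj => ?_)
    (fun j hj => ?_)
  · rw [Finset.mem_sdiff] at hj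
    have hlt := height_lt_of_notMem hj₀ hj.1 hj.2
    rw [HahnSeries.coeff_single_mul, monomial, HahnSeries.coeff_eq_zero_of_lt_order, mul_zero]
    have := val_monomial j z
    rw [val, ← hx] at this
    rw [height, height] at hlt
    rw [height]
    linarith
  · have heq := height_eq_of_mem hj hj₀
    rw [HahnSeries.coeff_single_mul]
    congr 1
    have h1 : ((∏ i, z i ^ j i : Puiseuxˣ) : Puiseux).order = -height v j₀ x - v j := by
      have := val_monomial j z
      rw [val, ← hx] at this
      rw [← heq, height]
      linarith
    rw [monomial, monomial, ← h1, ← HahnSeries.leadingCoeff_eq, ← lead_monomial]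
    rfl

/-- The unit `s^r` of the field of Puiseux series. -/
def sPow (r : ℝ) : Puiseuxˣ :=
  Units.mk0 (HahnSeries.single r (1 : ℂ)) (HahnSeries.single_ne_zero one_ne_zero)

/-- `r ↦ s^r` as a homomorphism. -/
def sPowHom : Multiplicative ℝ →* Puiseuxˣ where
  toFun r := sPow r.toAdd
  map_one' := by ext1; simp [sPow]
  map_mul' q r := by ext1; simp [sPow]

theorem monomial_sPow (j : Fin m → ℤ) (x : Fin m → ℝ) :
    monomial j (fun i => sPow (-x i)) = HahnSeries.single (-(toReal j ⬝ᵥ x)) (1 : ℂ) := by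
  have h : ∏ i, sPowHom (Multiplicative.ofAdd (-x i)) ^ j i =
      sPowHom (∏ i, Multiplicative.ofAdd (-x i) ^ j i) := by simp
  have h2 : (∏ i, Multiplicative.ofAdd (-x i) ^ j i) =
      Multiplicative.ofAdd (-(toReal j ⬝ᵥ x)) := by
    apply Multiplicative.toAdd.injective
    simp [toAdd_prod, dotProduct, toReal]
  rw [h2] at h
  exact congrArg Units.val h

theorem order_eq_zero_of_norm_sub_C_lt_one {u : Puiseux} {c : ℂ} (hc : c ≠ 0)
    (h : ‖u - HahnSeries.C c‖ < 1) : u.order = 0 ∧ u.leadingCoeff = c := by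
  rw [norm_puiseux_lt_one_iff] at h
  have h0 : u.coeff 0 = c := by
    have := h 0 le_rfl
    rw [HahnSeries.coeff_sub, HahnSeries.C_apply, HahnSeries.coeff_single_same, sub_eq_zero] at this
    exact this
  have hneg : ∀ g < 0, u.coeff g = 0 := fun g hg => by
    have := h g hg.le
    rwa [HahnSeries.coeff_sub, HahnSeries.C_apply, HahnSeries.coeff_single_of_ne hg.ne,
      sub_zero] at this
  have hu : u ≠ 0 := by
    rintro rfl
    exact hc h0.symm
  have ho : u.order = 0 := by
    refine le_antisymm (HahnSeries.order_le_of_coeff_ne_zero (by rwa [h0])) ?_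
    exact (HahnSeries.le_order_iff_forall hu).mpr hneg
  exact ⟨ho, by rw [HahnSeries.leadingCoeff_eq, ho, h0]⟩

/-- Over constants, the polynomial `∑ a_j s^{δ_j} z^j` is congruent to its initial form. -/
theorem norm_laurentSum_sub_lt_one {x : Fin m → ℝ} {j₀ : Fin m → ℤ}
    (hj₀ : j₀ ∈ initialSupport A v x) (c : Fin m → ℂˣ) :
    ‖laurentSum A (fun j => HahnSeries.single (height v j₀ x - height v j x) (a j) :
        (Fin m → ℤ) → Puiseux)
        (fun i => Units.map ((HahnSeries.C : ℂ →+* Puiseux) : ℂ →* Puiseux) (c i)) -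
      HahnSeries.C (laurentSum (initialSupport A v x) a c)‖ < 1 := by
  simp only [laurentSum, monomial_map, map_sum, map_mul]
  rw [← Finset.sum_sdiff (initialSupport_subset (A := A) (v := v) x), add_sub_assoc,
    ← Finset.sum_sub_distrib, Finset.sum_eq_zero (s := initialSupport A v x), add_zero]
  · refine norm_sum_lt_one _ _ fun j hj => ?_
    rw [Finset.mem_sdiff] at hj
    have hlt := height_lt_of_notMem hj₀ hj.1 hj.2
    rw [norm_mul]
    refine (mul_le_of_le_one_right (norm_nonneg _) (norm_C_le _)).trans_lt ?_
    by_cases ha : a j = 0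
    · simp [ha]
    · rw [norm_single ha, Real.exp_lt_one_iff]
      linarith
  · intro j hj
    rw [height_eq_of_mem hj hj₀, sub_self, ← HahnSeries.C_apply, sub_self]

/-- Every zero of the initial form at `x` lifts to a point of the hypersurface over the Puiseux
series with valuation `x`. -/
theorem exists_lift (ha : ∀ j ∈ A, a j ≠ 0) (hA : A.Nonempty) {x : Fin m → ℝ} {c : Fin m → ℂˣ}
    (hc : laurentSum (initialSupport A v x) a c = 0) :
    ∃ z ∈ hypersurfaceK A a v, (∀ i, val (z i) = x i) ∧ ∀ i, lead (z i) = c i := by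
  obtain ⟨j₀, hj₀⟩ := initialSupport_nonempty (v := v) hA x
  obtain ⟨c₁, hc₁⟩ := exists_laurentSum_ne_zero (initialSupport_nonempty (v := v) hA x)
    fun j hj => ha j (initialSupport_subset x hj)
  set b : (Fin m → ℤ) → Puiseux :=
    fun j => HahnSeries.single (height v j₀ x - height v j x) (a j) with hb
  let ι : ℂˣ →* Puiseuxˣ := Units.map ((HahnSeries.C : ℂ →+* Puiseux) : ℂ →* Puiseux)
  have hι : ∀ y : ℂˣ, ((ι y : Puiseuxˣ) : Puiseux) = HahnSeries.C (y : ℂ) := fun y => rfl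
  have hιn : ∀ y : ℂˣ, ‖((ι y : Puiseuxˣ) : Puiseux)‖ = 1 := fun y => by
    rw [hι, norm_C y.ne_zero]
  have hιprod : ∀ y : Fin m → ℂˣ,
      ‖(∏ i, ((ι (y i) : Puiseuxˣ) : Puiseux)) ^ clearingExponent A‖ = 1 :=
    fun y => by
      rw [norm_pow, norm_prod]
      simp only [hιn, Finset.prod_const_one, one_pow]
  have h0 : ‖laurentSum A b fun i => ι (c i)‖ < 1 := by
    have := norm_laurentSum_sub_lt_one (a := a) hj₀ c
    rwa [hc, map_zero, sub_zero] at this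
  have h1 : 1 ≤ ‖laurentSum A b fun i => ι (c₁ i)‖ := by
    have h := norm_laurentSum_sub_lt_one (a := a) hj₀ c₁
    by_contra! hlt
    have h2 := norm_sub_le_max (laurentSum A b fun i => ι (c₁ i))
      (laurentSum A b (fun i => ι (c₁ i)) -
        HahnSeries.C (laurentSum (initialSupport A v x) a c₁))
    rw [sub_sub_cancel, norm_C hc₁] at h2
    exact absurd (h2.trans_lt (max_lt hlt h)) (lt_irrefl _)
  have hdiff : ∀ ζ : Puiseux, ‖ζ‖ < 1 → ∀ i,
      ‖((ι (c i) : Puiseuxˣ) : Puiseux) +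
        ζ * (((ι (c₁ i) : Puiseuxˣ) : Puiseux) - ((ι (c i) : Puiseuxˣ) : Puiseux)) -
          HahnSeries.C (c i : ℂ)‖ < 1 := by
    intro ζ hζ i
    rw [← hι, add_sub_cancel_left, norm_mul, hι, hι, ← map_sub]
    exact (mul_le_of_le_one_right (norm_nonneg _) (norm_C_le _)).trans_lt hζ
  obtain ⟨ζ, hζ, u, hu, huz⟩ := exists_zero_on_line A b (fun i => ι (c i)) (fun i => ι (c₁ i))
    (K := 1) (ρ := 1) le_rfl
    (fun α hα => by
      rw [one_mul]
      exact (norm_sub_le_max 1 α).trans (by rw [norm_one, max_eq_right hα]))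
    (fun ζ hζ i h => by
      have := hdiff ζ hζ i
      rw [h, zero_sub, norm_neg, norm_C (c i).ne_zero] at this
      exact lt_irrefl _ this)
    (by
      rw [one_pow, one_mul, norm_mul, norm_mul, hιprod, hιprod, one_mul, one_mul]
      exact h0.trans_le h1)
  have hou := fun i => order_eq_zero_of_norm_sub_C_lt_one (c i).ne_zero
    (by rw [hu i]; exact hdiff ζ hζ i : ‖(u i : Puiseux) - HahnSeries.C (c i : ℂ)‖ < 1)
  refine ⟨fun i => sPow (-x i) * u i, ?_, fun i => ?_, fun i => ?_⟩
  · change patchPolyK A a v _ = 0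
    have : patchPolyK A a v (fun i => sPow (-x i) * u i) =
        HahnSeries.single (-height v j₀ x) (1 : ℂ) * laurentSum A b u := by
      rw [patchPolyK, laurentSum, Finset.mul_sum]
      refine Finset.sum_congr rfl fun j _ => ?_
      rw [monomial_mul, monomial_sPow, ← mul_assoc, ← mul_assoc, HahnSeries.single_mul_single, hb,
        HahnSeries.single_mul_single, one_mul, mul_one]
      congr 3
      simp only [height]
      ring
    rw [this, huz, mul_zero]
  · rw [val, Units.val_mul, HahnSeries.order_mul (sPow _).ne_zero (u i).ne_zero, (hou i).1]
    simp [sPow]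
  · ext
    simp [lead, sPow, HahnSeries.leadingCoeff_mul, (hou i).2]

end

/-! ### Rescaling the complex torus -/

section

variable {m : ℕ} {A : Finset (Fin m → ℤ)} {a : (Fin m → ℤ) → ℂ} {v : (Fin m → ℤ) → ℝ}

/-- The point `e^r y` of the torus, where the exponential is taken coordinatewise. -/
def expMul (r : Fin m → ℝ) (y : Fin m → ℂˣ) : Fin m → ℂˣ := fun i => ofPolar (r i) 1 * y i

theorem monomial_expMul (j : Fin m → ℤ) (r : Fin m → ℝ) (y : Fin m → ℂˣ) :
    monomial j (expMul r y) = (Real.exp (toReal j ⬝ᵥ r) : ℂ) * monomial j y := by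
  unfold expMul
  rw [monomial_mul]
  congr 1
  simp only [monomial, Units.coe_prod, Units.val_zpow_eq_zpow_val, ofPolar, Units.val_mk0,
    Circle.coe_one, mul_one]
  rw [dotProduct, Real.exp_sum]
  push_cast
  refine Finset.prod_congr rfl fun i _ => ?_
  rw [toReal, Complex.ofReal_intCast, Complex.exp_int_mul]

theorem norm_expMul (r : Fin m → ℝ) (y : Fin m → ℂˣ) (i : Fin m) :
    ‖(expMul r y i : ℂ)‖ = Real.exp (r i) * ‖(y i : ℂ)‖ := by
  simp [expMul, ofPolar]

theorem coe_phase (c : ℂˣ) : (phase c : ℂ) = (c : ℂ) / (‖(c : ℂ)‖ : ℂ) := rfl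

theorem phase_expMul (r : Fin m → ℝ) (y : Fin m → ℂˣ) (i : Fin m) :
    phase (expMul r y i) = phase (y i) := by
  ext
  rw [coe_phase, coe_phase, norm_expMul]
  have := (Real.exp_pos (r i)).ne'
  simp only [expMul, ofPolar, Units.val_mul, Units.val_mk0, Circle.coe_one, mul_one]
  push_cast
  rw [mul_div_mul_left]
  exact_mod_cast this

theorem phase_toUnits (θ : Circle) : phase (Circle.toUnits θ) = θ := by
  ext
  change (θ : ℂ) / (‖(θ : ℂ)‖ : ℂ) = θ
  rw [Circle.norm_coe, Complex.ofReal_one, div_one]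

theorem phase_ofPolar (x : ℝ) (θ : Circle) : phase (ofPolar x θ) = θ := by
  ext
  rw [coe_phase]
  have := (Real.exp_pos x).ne'
  simp only [ofPolar, Units.val_mk0, norm_mul, Circle.norm_coe, mul_one, Complex.norm_real,
    Real.norm_eq_abs, Real.abs_exp]
  rw [mul_div_cancel_left₀]
  exact_mod_cast this

/-- Over `Log_t = x`, the values of `f_t` are those of the Laurent polynomial with coefficients
`a_j t^{⟨j, x⟩ - v(j)}`. -/
theorem patchPoly_expMul {t : ℝ} (ht : 0 < t) (x : Fin m → ℝ) (y : Fin m → ℂˣ) :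
    patchPoly A a v t (expMul (Real.log t • x) y) =
      laurentSum A (fun j => a j * ((t ^ height v j x : ℝ) : ℂ)) y := by
  refine Finset.sum_congr rfl fun j _ => ?_
  beta_reduce
  rw [monomial_expMul, show height v j x = -v j + toReal j ⬝ᵥ x from sub_eq_neg_add _ _,
    Real.rpow_add ht, dotProduct_smul, smul_eq_mul,
    ← Real.rpow_def_of_pos ht]
  push_cast
  ring

theorem logb_norm_expMul {t : ℝ} (ht : 1 < t) (x : Fin m → ℝ) (y : Fin m → ℂˣ) (i : Fin m) :
    Real.logb t ‖(expMul (Real.log t • x) y i : ℂ)‖ =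
      x i + Real.log ‖(y i : ℂ)‖ / Real.log t := by
  have hl := (Real.log_pos ht).ne'
  rw [norm_expMul, Real.logb, Real.log_mul (Real.exp_pos _).ne'
    (norm_ne_zero_iff.mpr (y i).ne_zero), Real.log_exp, Pi.smul_apply, smul_eq_mul, add_div,
    mul_div_cancel_left₀ _ hl]

theorem expMul_logb_phase {t : ℝ} (ht : 1 < t) (z : Fin m → ℂˣ) :
    expMul (Real.log t • fun i => Real.logb t ‖(z i : ℂ)‖)
      (fun i => Circle.toUnits (phase (z i))) = z := by
  funext i
  ext
  have h0 : (0 : ℝ) < ‖(z i : ℂ)‖ := norm_pos_iff.mpr (z i).ne_zero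
  have hl := (Real.log_pos ht).ne'
  have h1 : ((‖(z i : ℂ)‖ : ℝ) : ℂ) ≠ 0 := by exact_mod_cast h0.ne'
  simp only [expMul, ofPolar, Pi.smul_apply, smul_eq_mul, Real.logb, Units.val_mul, Units.val_mk0,
    Circle.coe_one, mul_one, mul_div_cancel₀ _ hl, Real.exp_log h0]
  change ((‖(z i : ℂ)‖ : ℝ) : ℂ) * (phase (z i) : ℂ) = z i
  rw [coe_phase, mul_div_cancel₀ _ h1]

theorem height_sub (j : Fin m → ℤ) (x w : Fin m → ℝ) :
    height v j (x - w) = height v j x - toReal j ⬝ᵥ w := by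
  rw [height, height, dotProduct_sub]
  ring

theorem exists_ultrafilter_of_not_eventually {α β : Type*} [Nonempty β] {l : Filter α}
    {P : α → β → Prop} (h : ¬ ∀ᶠ t in l, ∀ z, P t z) :
    ∃ U : Ultrafilter α, (U : Filter α) ≤ l ∧ ∃ z : α → β, ∀ᶠ t in (U : Filter α), ¬ P t (z t) := by
  have hne : (l ⊓ 𝓟 {t | ¬ ∀ z, P t z}).NeBot := frequently_iff_neBot.mp (not_eventually.mp h)
  have hle := Ultrafilter.of_le (l ⊓ 𝓟 {t | ¬ ∀ z, P t z})
  refine ⟨_, hle.trans inf_le_left, fun t => Classical.epsilon fun z => ¬ P t z, ?_⟩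
  filter_upwards [le_principal_iff.mp (hle.trans inf_le_right)] with t ht
  exact Classical.epsilon_spec (not_forall.mp ht)

theorem exists_tendsto_ultrafilter {α X : Type*} [TopologicalSpace X] [CompactSpace X]
    (U : Ultrafilter α) (f : α → X) : ∃ y, Tendsto f U (𝓝 y) :=
  ⟨_, (U.map f).le_nhds_lim⟩

theorem exists_pseudoinverse {E F : Type*} [AddCommGroup E] [Module ℝ E] [AddCommGroup F]
    [Module ℝ F] (L : E →ₗ[ℝ] F) : ∃ G : F →ₗ[ℝ] E, ∀ x, L (G (L x)) = L x := by
  obtain ⟨g, hg⟩ := L.rangeRestrict.exists_rightInverse_of_surjective L.range_rangeRestrict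
  obtain ⟨G, hG⟩ := LinearMap.exists_extend g
  refine ⟨G, fun x => ?_⟩
  have h1 : G (L x) = g (L.rangeRestrict x) := LinearMap.congr_fun hG (L.rangeRestrict x)
  have h2 := LinearMap.congr_fun hg (L.rangeRestrict x)
  rw [h1]
  exact congrArg Subtype.val h2

/-! ### Points of the hypersurfaces are close to the limit -/

/-- The linear map recording `⟨j - j₀, x⟩` for `j ∈ B`. -/
def differences (B : Finset (Fin m → ℤ)) (j₀ : Fin m → ℤ) : (Fin m → ℝ) →ₗ[ℝ] (B → ℝ) where
  toFun x j := toReal j.1 ⬝ᵥ x - toReal j₀ ⬝ᵥ x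
  map_add' x y := by
    ext j
    simp only [dotProduct_add, Pi.add_apply]
    ring
  map_smul' r x := by
    ext j
    simp only [dotProduct_smul, smul_eq_mul, RingHom.id_apply, Pi.smul_apply]
    ring

theorem continuous_monomial_toUnits (j : Fin m → ℤ) :
    Continuous fun θ : Fin m → Circle => monomial j fun i => Circle.toUnits (θ i) := by
  have : (fun θ : Fin m → Circle => monomial j fun i => Circle.toUnits (θ i)) =
      fun θ => ((∏ i, θ i ^ j i : Circle) : ℂ) := by
    funext θ
    simp only [monomial, ← map_zpow, ← map_prod]
    rfl
  rw [this]
  fun_prop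

/-- Along an ultrafilter the monomials `t^{⟨j, x⟩ - v(j)}` of a zero `(x, θ)` of `f_t`, divided by
the largest one, converge to limits `ρ_j`. Let `B` be the set of exponents with
`ρ_j ≠ 0`. Since the range of the linear map `differences` is closed, there are points at which the
heights of all `j ∈ B` agree, and `j ↦ ρ_j` is on `B` the exponential of an affine function, which
provides the zero `c`. The heights on `B` differ by `O(1 / log t)` at `x`, and the others are lower
by much more, so `B` is the initial support at a point at distance `O(1 / log t)` from `x`. -/
theorem exists_truncation_zero_near (hA : A.Nonempty) {ε : ℝ} (hε : 0 < ε) :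
    ∀ᶠ t in atTop, ∀ z ∈ hypersurface A a v t, ∃ (x : Fin m → ℝ) (c : Fin m → ℂˣ),
      laurentSum (initialSupport A v x) a c = 0 ∧
      (∀ i, |Real.logb t ‖(z i : ℂ)‖ - x i| ≤ ε) ∧ ∀ i, dist (phase (z i)) (phase (c i)) ≤ ε := by
  classical
  by_contra hcon
  obtain ⟨U, hU, z, hbad⟩ := exists_ultrafilter_of_not_eventually hcon
  have hz := hbad.mono fun t ht => Classical.not_imp.mp ht
  have hone : ∀ᶠ t in (U : Filter ℝ), 1 < t := hU (eventually_gt_atTop 1)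
  set x : ℝ → Fin m → ℝ := fun t i => Real.logb t ‖(z t i : ℂ)‖ with hx
  obtain ⟨θ, hθ⟩ := exists_tendsto_ultrafilter U fun t i => phase (z t i)
  obtain ⟨j₀, hj₀A, hj₀⟩ : ∃ j₀ ∈ (A : Set (Fin m → ℤ)), ∀ᶠ t in (U : Filter ℝ),
      ∀ k ∈ A, height v k (x t) ≤ height v j₀ (x t) := by
    rw [← Ultrafilter.eventually_exists_mem_iff A.finite_toSet]
    exact Eventually.of_forall fun t => A.exists_max_image (fun j => height v j (x t)) hA
  -- The limits `ρ_j` of the normalized monomials.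
  have hρ : ∀ j ∈ A, ∃ r ∈ Set.Icc (0 : ℝ) 1,
      Tendsto (fun t => t ^ (height v j (x t) - height v j₀ (x t))) U (𝓝 r) := by
    intro j hj
    refine isCompact_Icc.ultrafilter_le_nhds' (U.map _) (Ultrafilter.mem_map.mpr ?_)
    change ∀ᶠ t in (U : Filter ℝ), _ ∈ Set.Icc (0 : ℝ) 1
    filter_upwards [hone, hj₀] with t ht hmax
    exact ⟨Real.rpow_nonneg (by linarith) _,
      Real.rpow_le_one_of_one_le_of_nonpos ht.le (sub_nonpos.mpr (hmax j hj))⟩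
  choose! ρ hρI hρ using hρ
  have heq : ∑ j ∈ A, a j * (ρ j : ℂ) * monomial j (fun i => Circle.toUnits (θ i)) = 0 := by
    have hlim : Tendsto (fun t => ∑ j ∈ A,
        a j * ((t ^ (height v j (x t) - height v j₀ (x t)) : ℝ) : ℂ) *
          monomial j (fun i => Circle.toUnits (phase (z t i)))) U
        (𝓝 (∑ j ∈ A, a j * (ρ j : ℂ) * monomial j (fun i => Circle.toUnits (θ i)))) := by
      refine tendsto_finsetSum _ fun j hj => ?_
      refine (((Complex.continuous_ofReal.tendsto _).comp (hρ j hj)).const_mul (a j)).mul ?_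
      exact ((continuous_monomial_toUnits j).tendsto θ).comp hθ
    refine tendsto_nhds_unique hlim (tendsto_const_nhds.congr' ?_)
    filter_upwards [hone, hz] with t ht hzt
    have h0 : patchPoly A a v t (z t) = 0 := hzt.1
    rw [← expMul_logb_phase ht (z t), patchPoly_expMul (by linarith)] at h0
    have ht0 : ((t ^ height v j₀ (x t) : ℝ) : ℂ) ≠ 0 := by
      exact_mod_cast (Real.rpow_pos_of_pos (by linarith) _).ne'
    refine (mul_left_cancel₀ ht0 ?_).symm
    rw [mul_zero, ← h0, laurentSum, Finset.mul_sum]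
    refine Finset.sum_congr rfl fun j _ => ?_
    rw [Real.rpow_sub (by linarith)]
    push_cast
    field_simp
    exact mul_right_comm _ _ _
  set B : Finset (Fin m → ℤ) := {j ∈ A | ρ j ≠ 0} with hB
  have hBA : B ⊆ A := Finset.filter_subset _ _
  have hρpos : ∀ j ∈ B, 0 < ρ j := fun j hj =>
    lt_of_le_of_ne (hρI j (hBA hj)).1 (Finset.mem_filter.mp hj).2.symm
  have hj₀B : j₀ ∈ B := by
    refine Finset.mem_filter.mpr ⟨hj₀A, ?_⟩
    have : ρ j₀ = 1 := by
      refine tendsto_nhds_unique (hρ j₀ hj₀A) (tendsto_const_nhds.congr fun t => ?_)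
      rw [sub_self, Real.rpow_zero]
    rw [this]
    exact one_ne_zero
  let L := differences B j₀
  let d : ℝ → B → ℝ := fun t j => height v j.1 (x t) - height v j₀ (x t)
  let w : B → ℝ := fun j => v j.1 - v j₀
  have hd : ∀ t, d t = L (x t) - w := by
    intro t
    ext j
    simp only [d, L, differences, w, height, LinearMap.coe_mk, AddHom.coe_mk, Pi.sub_apply]
    ring
  have hlogd : Tendsto (fun t => Real.log t • d t) U (𝓝 fun j => Real.log (ρ j.1)) := by
    refine tendsto_pi_nhds.mpr fun j => ?_
    refine (((Real.continuousAt_log (hρpos j.1 j.2).ne').tendsto).comp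
      (hρ j.1 (hBA j.2))).congr' ?_
    filter_upwards [hone] with t ht
    simp only [Function.comp_apply, Pi.smul_apply, smul_eq_mul, d]
    rw [Real.log_rpow (by linarith), mul_comm]
  have hlogU : Tendsto Real.log U atTop := Real.tendsto_log_atTop.mono_left hU
  have hd0 : Tendsto d U (𝓝 0) := by
    have h1 := (tendsto_inv_atTop_zero.comp hlogU).smul hlogd
    rw [zero_smul] at h1
    refine h1.congr' ?_
    filter_upwards [hone] with t ht
    simp only [Function.comp_apply]
    rw [smul_smul, inv_mul_cancel₀ (Real.log_pos ht).ne', one_smul]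
  have hclosed : IsClosed (L.range : Set (B → ℝ)) := L.range.closed_of_finiteDimensional
  obtain ⟨y, hy⟩ : w ∈ L.range := by
    have h1 : Tendsto (fun t => L (x t)) U (𝓝 w) := by
      have := hd0.add_const w
      rw [zero_add] at this
      refine this.congr fun t => ?_
      rw [hd, sub_add_cancel]
    exact hclosed.mem_of_tendsto h1 (Eventually.of_forall fun t => ⟨x t, rfl⟩)
  have hdL : ∀ t, d t = L (x t - y) := fun t => by rw [hd, map_sub, hy]
  obtain ⟨ℓ, hℓ⟩ : (fun j : B => Real.log (ρ j.1)) ∈ L.range :=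
    hclosed.mem_of_tendsto hlogd (Eventually.of_forall fun t =>
      ⟨Real.log t • (x t - y), by rw [map_smul, hdL]⟩)
  obtain ⟨G, hG⟩ := exists_pseudoinverse L
  have hGc : Continuous G := G.continuous_of_finiteDimensional
  have hG0 : Tendsto (fun t => G (d t)) U (𝓝 0) := by
    have := (hGc.tendsto 0).comp hd0
    rwa [map_zero] at this
  -- On `B` the heights agree at the corrected point; elsewhere they are smaller.
  have hin : ∀ t, ∀ j ∈ B, height v j (x t - G (d t)) = height v j₀ (x t - G (d t)) := by
    intro t j hj
    have h1 : L (x t - G (d t)) = w := by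
      rw [map_sub, hdL, hG, ← map_sub, sub_sub_cancel, hy]
    have h2 := congrFun h1 ⟨j, hj⟩
    simp only [L, differences, w, LinearMap.coe_mk, AddHom.coe_mk] at h2
    rw [height, height]
    linarith
  have hout : ∀ j ∈ A, j ∉ B → ∀ᶠ t in (U : Filter ℝ),
      height v j (x t - G (d t)) < height v j₀ (x t - G (d t)) := by
    intro j hj hjB
    have hρ0 : ρ j = 0 := by
      by_contra h
      exact hjB (Finset.mem_filter.mpr ⟨hj, h⟩)
    have hG1 : Tendsto (fun t => G (Real.log t • d t)) U (𝓝 (G fun j => Real.log (ρ j.1))) :=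
      (hGc.tendsto _).comp hlogd
    have hlin : Continuous fun e : Fin m → ℝ =>
        Real.exp (-(toReal j ⬝ᵥ e - toReal j₀ ⬝ᵥ e)) := by
      unfold dotProduct
      fun_prop
    have h1 := (hρ j hj).mul ((hlin.tendsto _).comp hG1)
    rw [hρ0, zero_mul] at h1
    filter_upwards [hone, h1.eventually_lt_const one_pos] with t ht hlt
    simp only [Function.comp_apply, map_smul, dotProduct_smul, smul_eq_mul] at hlt
    rw [Real.rpow_def_of_pos (by linarith), ← Real.exp_add, Real.exp_lt_one_iff, ← mul_sub,
      ← mul_neg, ← mul_add] at hlt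
    have := neg_of_mul_neg_right hlt (Real.log_pos ht).le
    rw [height_sub, height_sub]
    linarith
  have hsupp : ∀ᶠ t in (U : Filter ℝ), initialSupport A v (x t - G (d t)) = B := by
    have : ∀ᶠ t in (U : Filter ℝ), ∀ j ∈ A, j ∉ B →
        height v j (x t - G (d t)) < height v j₀ (x t - G (d t)) := by
      rw [eventually_all_finset]
      intro j hj
      by_cases hjB : j ∈ B
      · exact Eventually.of_forall fun t h => absurd hjB h
      · exact (hout j hj hjB).mono fun t h _ => h
    filter_upwards [this] with t ht
    have hle : ∀ k ∈ A, height v k (x t - G (d t)) ≤ height v j₀ (x t - G (d t)) := by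
      intro k hk
      by_cases hkB : k ∈ B
      · exact (hin t k hkB).le
      · exact (ht k hk hkB).le
    ext j
    rw [mem_initialSupport]
    constructor
    · rintro ⟨hj, hmax⟩
      by_contra hjB
      exact absurd (hmax j₀ hj₀A) (not_le.mpr (ht j hj hjB))
    · intro hj
      refine ⟨hBA hj, fun k hk => ?_⟩
      rw [hin t j hj]
      exact hle k hk
  let c : Fin m → ℂˣ := expMul ℓ fun i => Circle.toUnits (θ i)
  have hc : laurentSum B a c = 0 := by
    have h1 : laurentSum B a c = (Real.exp (toReal j₀ ⬝ᵥ ℓ) : ℂ) *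
        ∑ j ∈ A, a j * (ρ j : ℂ) * monomial j (fun i => Circle.toUnits (θ i)) := by
      rw [← Finset.sum_subset hBA, Finset.mul_sum]
      · refine Finset.sum_congr rfl fun j hj => ?_
        have h2 := congrFun hℓ ⟨j, hj⟩
        simp only [L, differences, LinearMap.coe_mk, AddHom.coe_mk] at h2
        have h3 : Real.exp (toReal j ⬝ᵥ ℓ) = Real.exp (toReal j₀ ⬝ᵥ ℓ) * ρ j := by
          rw [← Real.exp_log (hρpos j hj), ← Real.exp_add, ← h2, add_sub_cancel]
        rw [monomial_expMul, h3]
        push_cast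
        ring
      · intro j hj hjB
        have hρ0 : ρ j = 0 := by
          by_contra h
          exact hjB (Finset.mem_filter.mpr ⟨hj, h⟩)
        simp [hρ0]
    rw [h1, heq, mul_zero]
  have hnear1 : ∀ᶠ t in (U : Filter ℝ), ∀ i, |G (d t) i| ≤ ε := by
    rw [eventually_all]
    intro i
    have := ((tendsto_pi_nhds.mp hG0 i).abs).eventually_le_const (u := ε) (by simpa using hε)
    exact this
  have hnear2 : ∀ᶠ t in (U : Filter ℝ), ∀ i, dist (phase (z t i)) (θ i) ≤ ε := by
    rw [eventually_all]
    intro i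
    exact ((tendsto_pi_nhds.mp hθ i).dist tendsto_const_nhds).eventually_le_const
      (by simpa using hε)
  obtain ⟨t, ht1, ht2, ht3, ht4⟩ := (hsupp.and (hnear1.and (hnear2.and hz))).exists
  refine ht4.2 ⟨x t - G (d t), c, by rw [ht1, hc], fun i => ?_, fun i => ?_⟩
  · have : Real.logb t ‖(z t i : ℂ)‖ - (x t - G (d t)) i = G (d t) i := by
      simp [hx]
    rw [this]
    exact ht2 i
  · rw [phase_expMul, phase_toUnits]
    exact ht3 i

end

/-! ### Points of the limit are close to the hypersurfaces -/

section

variable {m : ℕ} {A : Finset (Fin m → ℤ)} {a : (Fin m → ℤ) → ℂ} {v : (Fin m → ℤ) → ℝ}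

/-- On a short initial piece of a complex line the phases stay close and the logarithms of the norms
stay bounded. -/
theorem exists_radius_line (y₀ y₁ : Fin m → ℂˣ) {ε : ℝ} (hε : 0 < ε) :
    ∃ ρ > 0, ∀ ζ : ℂ, ‖ζ‖ < ρ → ∀ i, (y₀ i : ℂ) + ζ * (y₁ i - y₀ i) ≠ 0 ∧
      ∀ u : ℂˣ, (u : ℂ) = y₀ i + ζ * (y₁ i - y₀ i) → dist (phase u) (phase (y₀ i)) ≤ ε ∧
        |Real.log ‖(u : ℂ)‖ - Real.log ‖(y₀ i : ℂ)‖| ≤ 1 := by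
  suffices h : ∀ᶠ ζ : ℂ in 𝓝 0, ∀ i, (y₀ i : ℂ) + ζ * (y₁ i - y₀ i) ≠ 0 ∧
      ∀ u : ℂˣ, (u : ℂ) = y₀ i + ζ * (y₁ i - y₀ i) → dist (phase u) (phase (y₀ i)) ≤ ε ∧
        |Real.log ‖(u : ℂ)‖ - Real.log ‖(y₀ i : ℂ)‖| ≤ 1 by
    obtain ⟨ρ, hρ, h'⟩ := Metric.eventually_nhds_iff.mp h
    exact ⟨ρ, hρ, fun ζ hζ => h' (by simpa using hζ)⟩
  rw [eventually_all]
  intro i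
  have hg : Tendsto (fun ζ : ℂ => (y₀ i : ℂ) + ζ * (y₁ i - y₀ i)) (𝓝 0) (𝓝 (y₀ i : ℂ)) := by
    have : Continuous fun ζ : ℂ => (y₀ i : ℂ) + ζ * (y₁ i - y₀ i) := by fun_prop
    simpa using this.tendsto 0
  have hn : ‖(y₀ i : ℂ)‖ ≠ 0 := norm_ne_zero_iff.mpr (y₀ i).ne_zero
  have hph : Tendsto (fun w : ℂ => ‖w / (‖w‖ : ℂ) - y₀ i / (‖(y₀ i : ℂ)‖ : ℂ)‖) (𝓝 (y₀ i : ℂ))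
      (𝓝 0) := by
    have h1 : Tendsto (fun w : ℂ => w / (‖w‖ : ℂ)) (𝓝 (y₀ i : ℂ))
        (𝓝 (y₀ i / (‖(y₀ i : ℂ)‖ : ℂ))) :=
      tendsto_id.div ((Complex.continuous_ofReal.comp continuous_norm).tendsto _)
        (by exact_mod_cast hn)
    have h2 := (h1.sub_const (y₀ i / (‖(y₀ i : ℂ)‖ : ℂ))).norm
    rwa [sub_self, norm_zero] at h2
  have hlog : Tendsto (fun w : ℂ => |Real.log ‖w‖ - Real.log ‖(y₀ i : ℂ)‖|) (𝓝 (y₀ i : ℂ))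
      (𝓝 0) := by
    have h1 : Tendsto (fun w : ℂ => Real.log ‖w‖) (𝓝 (y₀ i : ℂ)) (𝓝 (Real.log ‖(y₀ i : ℂ)‖)) :=
      (Real.continuousAt_log hn).tendsto.comp continuous_norm.continuousAt.tendsto
    have h2 := (h1.sub_const (Real.log ‖(y₀ i : ℂ)‖)).abs
    rwa [sub_self, abs_zero] at h2
  filter_upwards [hg.eventually_ne (y₀ i).ne_zero, (hph.comp hg).eventually_le_const hε,
    (hlog.comp hg).eventually_le_const one_pos] with ζ h1 h2 h3
  refine ⟨h1, fun u hu => ⟨?_, ?_⟩⟩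
  · change dist (phase u : ℂ) (phase (y₀ i) : ℂ) ≤ ε
    rw [dist_eq_norm, coe_phase, coe_phase, hu]
    exact h2
  · rw [hu]
    exact h3

/-- After passing to an ultrafilter the initial support `B` at `x` is constant. A fixed small
translation `u = η (x_p - x_q)` moves all `x` so far into the interior of the cell of `B` that the
terms outside `B` become uniformly negligible. A fixed zero `y₀` of the initial form, with nearly
the right phases, is then perturbed along a line to a zero of `f_t`. -/
theorem exists_hypersurface_point_near (ha : ∀ j ∈ A, a j ≠ 0) (hA : A.Nonempty) {ε : ℝ}
    (hε : 0 < ε) :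
    ∀ᶠ t in atTop, ∀ p : (Fin m → ℝ) × (Fin m → ℂˣ),
      laurentSum (initialSupport A v p.1) a p.2 = 0 →
      ∃ z ∈ hypersurface A a v t,
        (∀ i, |Real.logb t ‖(z i : ℂ)‖ - p.1 i| ≤ ε) ∧
        ∀ i, dist (phase (z i)) (phase (p.2 i)) ≤ ε := by
  by_contra hcon
  obtain ⟨U, hU, p, hbad⟩ := exists_ultrafilter_of_not_eventually hcon
  replace hbad := hbad.mono fun t ht => Classical.not_imp.mp ht
  have hone : ∀ᶠ t in (U : Filter ℝ), 1 < t := hU (eventually_gt_atTop 1)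
  set x : ℝ → Fin m → ℝ := fun t => (p t).1 with hx
  set c : ℝ → Fin m → ℂˣ := fun t => (p t).2
  obtain ⟨θ, hθ⟩ := exists_tendsto_ultrafilter U fun t i => phase (c t i)
  have hθε : ∀ᶠ t in (U : Filter ℝ), ∀ i, dist (phase (c t i)) (θ i) ≤ ε / 4 := by
    rw [eventually_all]
    intro i
    exact ((tendsto_pi_nhds.mp hθ i).dist tendsto_const_nhds).eventually_le_const
      (by rw [dist_self]; positivity)
  obtain ⟨B, -, hB⟩ : ∃ B ∈ (A.powerset : Set (Finset (Fin m → ℤ))),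
      ∀ᶠ t in (U : Filter ℝ), initialSupport A v (x t) = B := by
    rw [← Ultrafilter.eventually_exists_mem_iff A.powerset.finite_toSet]
    exact Eventually.of_forall fun t =>
      ⟨_, Finset.mem_coe.mpr (Finset.mem_powerset.mpr (initialSupport_subset _)), rfl⟩
  obtain ⟨τ, hτB, hτbad, hτθ⟩ := (hB.and (hbad.and hθε)).exists
  have hBA : B ⊆ A := hτB ▸ initialSupport_subset _
  have hBne : B.Nonempty := hτB ▸ initialSupport_nonempty hA _
  obtain ⟨j₀, hj₀⟩ := id hBne
  have hy₀ : laurentSum B a (c τ) = 0 := hτB ▸ hτbad.1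
  set y₀ := c τ
  obtain ⟨y₁, hy₁⟩ := exists_laurentSum_ne_zero hBne fun j hj => ha j (hBA hj)
  let δ : (Fin m → ℤ) → (Fin m → ℝ) → ℝ := fun j w => height v j₀ w - height v j w
  have hδB : ∀ w, initialSupport A v w = B → ∀ j ∈ B, δ j w = 0 := fun w hw j hj =>
    sub_eq_zero.mpr (height_eq_of_mem (A := A) (hw ▸ hj₀) (hw ▸ hj))
  have hδpos : ∀ w, initialSupport A v w = B → ∀ j ∈ A, j ∉ B → 0 < δ j w := fun w hw j hj hjB =>
    sub_pos.mpr (height_lt_of_notMem (A := A) (hw ▸ hj₀) hj (hw ▸ hjB))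
  -- Each gap either is eventually smaller than at the parameter `τ`, or is bounded below.
  obtain ⟨q, hqB, hq⟩ : ∃ q, initialSupport A v (x q) = B ∧ ∀ j ∈ A,
      δ j (x q) < δ j (x τ) ∨ ∀ᶠ t in (U : Filter ℝ), δ j (x τ) ≤ δ j (x t) := by
    refine (hB.and ((eventually_all_finset A).mpr fun j _ => ?_)).exists
    by_cases h : ∀ᶠ t in (U : Filter ℝ), δ j (x t) < δ j (x τ)
    · exact h.mono fun t ht => Or.inl ht
    · refine Eventually.of_forall fun _ => Or.inr ?_
      exact (Ultrafilter.eventually_not.mpr h).mono fun t ht => not_lt.mp ht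
  let κ : (Fin m → ℤ) → ℝ := fun j => δ j (x τ) - δ j (x q)
  have hδshift : ∀ j w (η : ℝ), δ j (w + η • (x τ - x q)) = δ j w + η * κ j := by
    intro j w η
    simp only [δ, κ, height, dotProduct_add, dotProduct_smul, dotProduct_sub, smul_eq_mul]
    ring
  obtain ⟨η, hηε, hηδ⟩ : ∃ η : ℝ, (∀ i, |η * (x τ - x q) i| ≤ ε / 2) ∧
      ∀ j ∈ A, j ∉ B → ∃ d > 0, ∀ᶠ t in (U : Filter ℝ), d ≤ δ j (x t + η • (x τ - x q)) := by
    have hsmall : ∀ r s : ℝ, 0 < s → ∀ᶠ η in 𝓝[>] (0 : ℝ), |η * r| ≤ s := by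
      intro r s hs
      have h1 : Tendsto (fun η : ℝ => |η * r|) (𝓝 0) (𝓝 |0 * r|) :=
        ((continuous_id.mul continuous_const).abs).tendsto 0
      exact (h1.mono_left nhdsWithin_le_nhds).eventually_le_const (by simpa using hs)
    refine (((eventually_all.mpr fun i => hsmall _ _ (half_pos hε)).and
      ((eventually_all_finset A).mpr fun j hj => ?_) :
        ∀ᶠ η in 𝓝[>] (0 : ℝ), _ ∧ _)).exists
    by_cases hjB : j ∈ B
    · exact Eventually.of_forall fun _ h => absurd hjB h
    rcases hq j hj with hlt | hge
    · filter_upwards [self_mem_nhdsWithin] with η hη _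
      refine ⟨η * κ j, mul_pos hη (sub_pos.mpr hlt), ?_⟩
      filter_upwards [hB] with t ht
      rw [hδshift]
      linarith [hδpos _ ht j hj hjB]
    · have hd := hδpos _ hτB j hj hjB
      filter_upwards [hsmall (κ j) (δ j (x τ) / 2) (half_pos hd)] with η hη _
      refine ⟨δ j (x τ) / 2, half_pos hd, ?_⟩
      filter_upwards [hge] with t ht
      rw [hδshift]
      linarith [(abs_le.mp hη).1]
  set x' : ℝ → Fin m → ℝ := fun t => x t + η • (x τ - x q) with hx'
  let b : ℝ → (Fin m → ℤ) → ℂ := fun t j => a j * ((t ^ (-δ j (x' t)) : ℝ) : ℂ)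
  have hblim : ∀ y : Fin m → ℂˣ,
      Tendsto (fun t => laurentSum A (b t) y) U (𝓝 (laurentSum B a y)) := by
    classical
    intro y
    have h1 : laurentSum B a y = ∑ j ∈ A, (if j ∈ B then a j else 0) * monomial j y := by
      rw [laurentSum, ← Finset.sum_subset hBA]
      · exact Finset.sum_congr rfl fun j hj => by rw [if_pos hj]
      · intro j _ hj
        rw [if_neg hj, zero_mul]
    rw [h1]
    refine tendsto_finsetSum _ fun j hj => Tendsto.mul_const _ ?_
    split_ifs with hjB
    · refine tendsto_const_nhds.congr' ?_
      filter_upwards [hB] with t ht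
      have h2 : δ j (x' t) = 0 := by
        rw [hx', hδshift]
        simp only [κ]
        rw [hδB _ ht j hjB, hδB _ hτB j hjB, hδB _ hqB j hjB]
        ring
      simp [b, h2]
    · obtain ⟨d, hd, hdt⟩ := hηδ j hj hjB
      have h2 : Tendsto (fun t : ℝ => t ^ (-δ j (x' t))) U (𝓝 0) := by
        refine squeeze_zero' (hone.mono fun t ht => Real.rpow_nonneg (by linarith) _) ?_
          ((tendsto_rpow_neg_atTop hd).mono_left hU)
        filter_upwards [hone, hdt] with t ht htd
        exact Real.rpow_le_rpow_of_exponent_le ht.le (neg_le_neg htd)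
      have h3 := ((Complex.continuous_ofReal.tendsto 0).comp h2).const_mul (a j)
      rwa [Complex.ofReal_zero, mul_zero] at h3
  obtain ⟨ρ, hρ, hline⟩ := exists_radius_line y₀ y₁ (half_pos hε)
  let E : (Fin m → ℂˣ) → ℂ := fun y => (∏ i, (y i : ℂ)) ^ clearingExponent A
  have hroot : ∀ᶠ t in (U : Filter ℝ), ∃ ζ : ℂ, ‖ζ‖ < ρ ∧ ∃ u : Fin m → ℂˣ,
      (∀ i, (u i : ℂ) = y₀ i + ζ * (y₁ i - y₀ i)) ∧ laurentSum A (b t) u = 0 := by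
    have h0 : Tendsto (fun t => (1 + 1 / ρ) ^ lineDegree A * ‖E y₀ * laurentSum A (b t) y₀‖) U
        (𝓝 0) := by
      have := (((hblim y₀).const_mul (E y₀)).norm).const_mul ((1 + 1 / ρ) ^ lineDegree A)
      rwa [hy₀, mul_zero, norm_zero, mul_zero] at this
    have h1 := ((hblim y₁).const_mul (E y₁)).norm
    have hE : 0 < ‖E y₁ * laurentSum B a y₁‖ := norm_pos_iff.mpr (mul_ne_zero
      (pow_ne_zero _ (Finset.prod_ne_zero_iff.mpr fun i _ => (y₁ i).ne_zero)) hy₁)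
    filter_upwards [h0.eventually_lt h1 hE] with t ht
    refine exists_zero_on_line A (b t) y₀ y₁ (K := 1 + 1 / ρ) (ρ := ρ)
      (le_add_of_nonneg_right (by positivity)) (fun α hα => ?_)
      (fun ζ hζ i => (hline ζ hζ i).1) ht
    have h2 : 1 ≤ 1 / ρ * ‖α‖ := by
      rw [one_div, inv_mul_eq_div, le_div_iff₀ hρ, one_mul]
      exact hα
    have h3 := norm_sub_le (1 : ℂ) α
    rw [norm_one] at h3
    linarith
  have hlogU : Tendsto Real.log U atTop := Real.tendsto_log_atTop.mono_left hU
  have hM : ∀ᶠ t in (U : Filter ℝ), ∀ i,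
      (1 + |Real.log ‖(y₀ i : ℂ)‖|) / Real.log t ≤ ε / 2 := by
    rw [eventually_all]
    intro i
    exact (tendsto_const_nhds.div_atTop hlogU).eventually_le_const (half_pos hε)
  obtain ⟨t, ht, ⟨ζ, hζ, u, hu, hu0⟩, hMt, hbadt, hθt⟩ :=
    (hone.and (hroot.and (hM.and (hbad.and hθε)))).exists
  refine hbadt.2 ⟨expMul (Real.log t • x' t) u, ?_, fun i => ?_, fun i => ?_⟩
  · change patchPoly A a v t _ = 0
    rw [patchPoly_expMul (by linarith)]
    have h1 : laurentSum A (fun j => a j * ((t ^ height v j (x' t) : ℝ) : ℂ)) u =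
        ((t ^ height v j₀ (x' t) : ℝ) : ℂ) * laurentSum A (b t) u := by
      rw [laurentSum, laurentSum, Finset.mul_sum]
      refine Finset.sum_congr rfl fun j _ => ?_
      have h2 : height v j (x' t) = height v j₀ (x' t) + -δ j (x' t) := by
        simp only [δ]
        ring
      rw [h2, Real.rpow_add (by linarith)]
      simp only [b]
      push_cast
      ring
    rw [h1, hu0, mul_zero]
  · have h1 := ((hline ζ hζ i).2 (u i) (hu i)).2
    have hl := Real.log_pos ht
    have h2 : |Real.log ‖(u i : ℂ)‖ / Real.log t| ≤ ε / 2 := by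
      rw [abs_div, abs_of_pos hl]
      refine le_trans (div_le_div_of_nonneg_right ?_ hl.le) (hMt i)
      have h3 := abs_sub_abs_le_abs_sub (Real.log ‖(u i : ℂ)‖) (Real.log ‖(y₀ i : ℂ)‖)
      linarith
    have h4 : Real.logb t ‖(expMul (Real.log t • x' t) u i : ℂ)‖ - (p t).1 i =
        η * (x τ - x q) i + Real.log ‖(u i : ℂ)‖ / Real.log t := by
      rw [logb_norm_expMul ht]
      simp only [hx', hx, Pi.add_apply, Pi.smul_apply, smul_eq_mul]
      ring
    rw [h4]
    refine (abs_add_le _ _).trans ?_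
    linarith [hηε i]
  · rw [phase_expMul]
    have h1 := ((hline ζ hζ i).2 (u i) (hu i)).1
    have h2 := dist_triangle (phase (u i)) (phase (y₀ i)) (phase (c t i))
    have h3 := dist_triangle_right (phase (y₀ i)) (phase (c t i)) (θ i)
    have h4 := hτθ i
    have h5 := hθt i
    change dist _ (phase (c t i)) ≤ ε
    linarith

end

/-! ### Hausdorff convergence -/

section

variable {m : ℕ} {A : Finset (Fin m → ℤ)} {a : (Fin m → ℤ) → ℂ} {v : (Fin m → ℤ) → ℝ}

theorem log_liftW (z : Fin m → Puiseuxˣ) : log (liftW z) = logK z := by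
  ext i
  simp [log, liftW, logK, ofPolar, Circle.norm_coe]

/-- Closeness in each coordinate gives closeness in the invariant metric of the torus. -/
theorem edist_polar_le {z w : Fin m → ℂˣ} {ε : ℝ} (hε : 0 ≤ ε)
    (hlog : ∀ i, |Real.log ‖(z i : ℂ)‖ - Real.log ‖(w i : ℂ)‖| ≤ ε)
    (hphase : ∀ i, dist (phase (z i)) (phase (w i)) ≤ ε) :
    edist (polar z) (polar w) ≤ ENNReal.ofReal ((m + 1) * ε) := by
  rw [edist_dist]
  refine ENNReal.ofReal_le_ofReal ?_
  rw [Prod.dist_eq, max_le_iff]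
  have hmε : 0 ≤ (m : ℝ) * ε := by positivity
  constructor
  · rw [EuclideanSpace.dist_eq]
    refine Real.sqrt_le_iff.mpr ⟨by positivity, ?_⟩
    calc ∑ i, dist ((polar z).1 i) ((polar w).1 i) ^ 2 ≤ ∑ _i : Fin m, ε ^ 2 := by
          refine Finset.sum_le_sum fun i _ => ?_
          exact pow_le_pow_left₀ dist_nonneg (hlog i) 2
      _ = m * ε ^ 2 := by simp
      _ ≤ ((m + 1) * ε) ^ 2 := by
          have : (0 : ℝ) ≤ m := Nat.cast_nonneg m
          nlinarith [sq_nonneg ε, mul_nonneg this (sq_nonneg ε),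
            mul_nonneg (mul_nonneg this this) (sq_nonneg ε)]
  · refine (dist_pi_le_iff (by positivity)).mpr fun i => (hphase i).trans ?_
    linarith

theorem tendsto_torusHausdorffEDist (ha : ∀ j ∈ A, a j ≠ 0) (hA : A.Nonempty) :
    Tendsto (fun t : ℝ =>
        torusHausdorffEDist (renorm t '' hypersurface A a v t) (liftW '' hypersurfaceK A a v))
      atTop (𝓝 0) := by
  rw [ENNReal.tendsto_nhds_zero]
  intro e he
  obtain ⟨r, hr, hre⟩ : ∃ r : ℝ, 0 < r ∧ ENNReal.ofReal r ≤ e := by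
    obtain ⟨r, hr0, hre⟩ := ENNReal.lt_iff_exists_nnreal_btwn.mp he
    exact ⟨r, by exact_mod_cast hr0, by rw [ENNReal.ofReal_coe_nnreal]; exact hre.le⟩
  have hm : (0 : ℝ) < m + 1 := by positivity
  set ε := r / (m + 1) with hε
  have hε0 : 0 < ε := div_pos hr hm
  have hεr : (m + 1) * ε = r := mul_div_cancel₀ _ hm.ne'
  filter_upwards [exists_truncation_zero_near (a := a) (v := v) hA hε0,
    exists_hypersurface_point_near (v := v) ha hA hε0] with t hto hfrom
  refine (Metric.hausdorffEDist_le_of_mem_edist ?_ ?_).trans hre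
  · rintro _ ⟨_, ⟨z, hz, rfl⟩, rfl⟩
    obtain ⟨x, c, hc, hlog, hphase⟩ := hto z hz
    obtain ⟨b, hb, hval, hlead⟩ := exists_lift ha hA hc
    refine ⟨_, ⟨_, ⟨b, hb, rfl⟩, rfl⟩, ?_⟩
    rw [← hεr]
    refine edist_polar_le hε0.le (fun i => ?_) fun i => ?_
    · simpa [renorm, liftW, ofPolar, Circle.norm_coe, hval i] using hlog i
    · rw [renorm, liftW, phase_ofPolar, phase_ofPolar, hlead i]
      exact hphase i
  · rintro _ ⟨_, ⟨b, hb, rfl⟩, rfl⟩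
    obtain ⟨z, hz, hlog, hphase⟩ := hfrom (fun i => val (b i), fun i => lead (b i))
      (laurentSum_lead_eq_zero hA hb)
    refine ⟨_, ⟨_, ⟨z, hz, rfl⟩, rfl⟩, ?_⟩
    rw [← hεr, edist_comm]
    refine edist_polar_le hε0.le (fun i => ?_) fun i => ?_
    · simpa [renorm, liftW, ofPolar, Circle.norm_coe] using hlog i
    · rw [renorm, liftW, phase_ofPolar, phase_ofPolar]
      exact hphase i

/-- The projection of the torus to `ℝᵐ` does not increase Hausdorff distances. -/
theorem hausdorffEDist_log_le (X Y : Set (Fin m → ℂˣ)) :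
    Metric.hausdorffEDist (log '' X) (log '' Y) ≤ torusHausdorffEDist X Y := by
  have key : ∀ X Y : Set (Fin m → ℂˣ), ∀ z ∈ log '' X,
      Metric.infEDist z (log '' Y) ≤ torusHausdorffEDist X Y := by
    rintro X Y _ ⟨z, hz, rfl⟩
    refine le_trans ?_ (Metric.infEDist_le_hausdorffEDist_of_mem (Set.mem_image_of_mem polar hz))
    refine Metric.le_infEDist.mpr ?_
    rintro _ ⟨w, hw, rfl⟩
    refine (Metric.infEDist_le_edist_of_mem (Set.mem_image_of_mem log hw)).trans ?_
    rw [Prod.edist_eq]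
    exact le_max_left _ _
  refine Metric.hausdorffEDist_le_of_infEDist (key X Y) fun z hz => ?_
  have := key Y X z hz
  rwa [torusHausdorffEDist, Metric.hausdorffEDist_comm] at this

end

end Patchworking

end

theorem theorem5 (n : ℕ) (Δ : Set (Fin (n + 1) → ℝ))
    (hΔ : Patchworking.IsLatticePolyhedron Δ) (hΔint : (interior Δ).Nonempty)
    (A : Finset (Fin (n + 1) → ℤ))
    (hA : (A : Set (Fin (n + 1) → ℤ)) = Patchworking.latticePoints Δ)
    (v : (Fin (n + 1) → ℤ) → ℝ) (a : (Fin (n + 1) → ℤ) → ℂ) (ha : ∀ j ∈ A, a j ≠ 0) :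
    Tendsto (fun t : ℝ =>
        Patchworking.torusHausdorffEDist
          (Patchworking.renorm t '' Patchworking.hypersurface A a v t)
          (Patchworking.liftW '' Patchworking.hypersurfaceK A a v))
      atTop (𝓝 0) ∧
    Tendsto (fun t : ℝ =>
        Metric.hausdorffEDist
          (Patchworking.logT t '' Patchworking.hypersurface A a v t)
          (Patchworking.logK '' Patchworking.hypersurfaceK A a v))
      atTop (𝓝 0) := by
  have hAne : A.Nonempty := by
    obtain ⟨S, rfl⟩ := hΔ
    obtain ⟨_, j, hj, rfl⟩ := convexHull_nonempty_iff.mp (hΔint.mono interior_subset)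
    have : j ∈ (A : Set (Fin (n + 1) → ℤ)) := by
      rw [hA]
      exact subset_convexHull ℝ _ (Set.mem_image_of_mem _ hj)
    exact ⟨j, this⟩
  have h := Patchworking.tendsto_torusHausdorffEDist (v := v) ha hAne
  refine ⟨h, tendsto_of_tendsto_of_tendsto_of_le_of_le tendsto_const_nhds h
    (fun _ => zero_le) fun t => ?_⟩
  have := Patchworking.hausdorffEDist_log_le
    (Patchworking.renorm t '' Patchworking.hypersurface A a v t)
    (Patchworking.liftW '' Patchworking.hypersurfaceK A a v)
  simpa only [Set.image_image, Patchworking.log_renorm, Patchworking.log_liftW] using this
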